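/- Let $d,n$ be integers with $3\le d\le n+1$, and let $$C_{d,n}=\overline{\{[L_0\cdots L_{d-1}] : L_0,\dots,L_{d-1}\in\mathbb C^{n+1}\setminus\{0\}\}}\subset\mathbb P(S^d\mathbb C^{n+1})$$ be the Chow variety, i.e. the Zariski closure of the set of classes of products of $d$ complex linear forms in $n+1$ variables. For a projective variety $V\subset\mathbb P^N$ let $T_xV$ denote the (projective) Zariski tangent space of $V$ at $x\in V$; a hyperplane $H$ is tangent to $V$ at $x$ if $T_xV\subseteq H$. An irreducible nondegenerate variety $V$ is called * *$1$-weakly defective* if, for a generic point $p\in V$ and a generic hyperplane $H\supseteq T_pV$, the contact locus $\{x\in V : T_xV\subseteq H\}$ has positive dimension; * *$1$-tangentially weakly defective* if, for a generic point $p\in V$, the tangential contact locus $\{x\in V : T_xV\subseteq T_pV\}$ has a component of positive dimension. Then $C_{d,n}$ is not $1$-weakly defective, and hence it is not $1$-tangentially weakly defective. -/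

import Mathlib

open scoped LinearAlgebra.Projectivization

noncomputable section

namespace ProjVar

/-- The complex projective space `ℙ^N` with homogeneous coordinates indexed by `ι`
(so `N + 1` is the number of elements of `ι`).  It is a separate definition because it carries
the Zariski topology. -/
def ProjSpace (ι : Type) : Type := ℙ ℂ (ι → ℂ)

variable {ι : Type}

namespace ProjSpace

/-- The point `[v]` of a nonzero vector `v`. -/
def mk (v : ι → ℂ) (hv : v ≠ 0) : ProjSpace ι := Projectivization.mk ℂ v hv

/-- A vector of homogeneous coordinates of a point.  Nothing below depends on the choice. -/
def coords (x : ProjSpace ι) : ι → ℂ := Projectivization.rep x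

/-- The set of points where the homogeneous polynomial `f` does not vanish. -/
def basicOpen (f : MvPolynomial ι ℂ) : Set (ProjSpace ι) :=
  {x | MvPolynomial.eval x.coords f ≠ 0}

/-- The Zariski topology: the sets `basicOpen f`, for `f` homogeneous, form a basis. -/
instance : TopologicalSpace (ProjSpace ι) :=
  TopologicalSpace.generateFrom
    {U | ∃ (k : ℕ) (f : MvPolynomial ι ℂ), f.IsHomogeneous k ∧ U = basicOpen f}

end ProjSpace

/-- The affine cone over a subset of projective space (including the origin). -/
def affineCone (X : Set (ProjSpace ι)) : Set (ι → ℂ) :=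
  {v | ∀ hv : v ≠ 0, ProjSpace.mk v hv ∈ X}

/-- `P` holds for the generic point of `T`: it holds on a dense open subset. -/
def Generically {T : Type} [TopologicalSpace T] (P : T → Prop) : Prop :=
  ∃ U : Set T, IsOpen U ∧ Dense U ∧ ∀ x ∈ U, P x

section

variable [Fintype ι]

/-- The differential at `v` of a polynomial function on `ℂ^ι`. -/
def differential (f : MvPolynomial ι ℂ) (v : ι → ℂ) : (ι → ℂ) →ₗ[ℂ] ℂ :=
  ∑ i, MvPolynomial.eval v (MvPolynomial.pderiv i f) • LinearMap.proj i

/-- The Zariski tangent space to the variety `X` at the point `x`, as a linear subspace of the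
vector space `ℂ^ι` (that is, the tangent space to the affine cone at a vector over `x`): the
common kernel of the differentials of all polynomials in the ideal of `X`. -/
def tangentSpace (X : Set (ProjSpace ι)) (x : ProjSpace ι) : Submodule ℂ (ι → ℂ) :=
  ⨅ f ∈ MvPolynomial.vanishingIdeal ℂ (affineCone X), LinearMap.ker (differential f x.coords)

/-- The hyperplane `∑ i, h i * v i = 0` (as a linear subspace of `ℂ^ι`), for a point `h` of the
dual projective space. -/
def hyperplane (h : ProjSpace ι) : Submodule ℂ (ι → ℂ) :=
  LinearMap.ker (∑ i, h.coords i • (LinearMap.proj i : (ι → ℂ) →ₗ[ℂ] ℂ))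

/-- The set of points `x` of `X` such that the tangent space to `X` at `x` is contained in the
linear space `Λ`. -/
def contactLocus (X : Set (ProjSpace ι)) (Λ : Submodule ℂ (ι → ℂ)) : Set (ProjSpace ι) :=
  {x | x ∈ X ∧ tangentSpace X x ≤ Λ}

/-- The hyperplanes tangent to `X` at `p`, a linear subspace of the dual projective space. -/
def tangentHyperplanes (X : Set (ProjSpace ι)) (p : ProjSpace ι) : Set (ProjSpace ι) :=
  {h | tangentSpace X p ≤ hyperplane h}

/-- `X` is `1`-weakly defective: the generic hyperplane tangent to `X` at a generic point is
tangent to `X` along a positive-dimensional locus.  (The dimension is the Krull dimension in the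
Zariski topology.) -/
def IsOneWeaklyDefective (X : Set (ProjSpace ι)) : Prop :=
  Generically fun p : X =>
    Generically fun h : tangentHyperplanes X p.1 =>
      0 < topologicalKrullDim (contactLocus X (hyperplane h.1))

/-- `X` is `1`-tangentially weakly defective: for a generic point `p` of `X`, the tangential
contact locus `{x ∈ X | T_x X ⊆ T_p X}` has a component of positive dimension. -/
def IsOneTangentiallyWeaklyDefective (X : Set (ProjSpace ι)) : Prop :=
  Generically fun p : X => 0 < topologicalKrullDim (contactLocus X (tangentSpace X p.1))

end

end ProjVar

namespace Chow

/-- The exponents of the monomials of degree `d` in `x_0, …, x_n`. -/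
abbrev Exponents (d n : ℕ) : Type :=
  ↥((Finset.univ : Finset (Fin (n + 1))).finsuppAntidiag d)

/-- The linear form `a_0 x_0 + ⋯ + a_n x_n`. -/
def linearForm {n : ℕ} (a : Fin (n + 1) → ℂ) : MvPolynomial (Fin (n + 1)) ℂ :=
  ∑ i, MvPolynomial.C (a i) * MvPolynomial.X i

/-- The coordinates of a form of degree `d` in `n + 1` variables: its coefficients. -/
def coeffs (d n : ℕ) (f : MvPolynomial (Fin (n + 1)) ℂ) : Exponents d n → ℂ :=
  fun m => MvPolynomial.coeff m.1 f

/-- The points `[L_0 ⋯ L_{d-1}]` of the projective space of forms of degree `d` in `n + 1`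
variables, for linear forms `L_i` with nonzero product. -/
def completelyDecomposable (d n : ℕ) : Set (ProjVar.ProjSpace (Exponents d n)) :=
  {x | ∃ (a : Fin d → Fin (n + 1) → ℂ) (h : coeffs d n (∏ k, linearForm (a k)) ≠ 0),
    x = ProjVar.ProjSpace.mk (coeffs d n (∏ k, linearForm (a k))) h}

/-- The Chow variety of zero-cycles `C_{d,n}`: the Zariski closure of the set of completely
decomposable forms of degree `d` in `n + 1` variables. -/
def chowVariety (d n : ℕ) : Set (ProjVar.ProjSpace (Exponents d n)) :=
  closure (completelyDecomposable d n)

end Chow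

end

/-!
The proof is a form of reflexivity: if the dual variety of `X` is a hypersurface `G = 0`, then the
general hyperplane tangent to `X` is tangent at one point only, the gradient of `G`.

Let `X` be parametrized by a polynomial map `φ` in `r` parameters, normalized so that the affine
cone has dimension `r + 1` (`IsParametrizedBy`). The rows `φ` and `∂φ/∂a_k` of the matrix `jet φ`
span the tangent space at `[φ a]` for generic `a`, because every further coordinate of the cone is
algebraic over `r + 1` of the coordinates (`IsParametrizedBy.exists_tangentSpace`). The conormal
variety, of the pairs of a point and a linear form `F` with `jet φ * F = 0`, is therefore
parametrized by one variable less than the number of coordinates (`conormalMap`), so its linear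
forms satisfy an equation `G`; one of least degree has a gradient that is not identically zero
(`exists_dual_equation`). If the second fundamental form in the direction `F` is nondegenerate,
then the tangent vectors of the conormal variety, which are its points over the dual numbers, show
that `∇G(F)` is proportional to `φ a` (`exists_pderiv_eq_smul`). Proportionality is a closed
condition and the second fundamental form is generically nondegenerate as soon as it is
nondegenerate at one point, so the same conclusion holds without the assumption on `F`
(`HasNondegenerateDual.mul_pderiv_eq`).

A hyperplane `F` tangent at an arbitrary point `x` of `X`, singular or not, is the differential at
`x` of some `f` in the ideal of `X`. The differentials of `f` at the points of `X` are conormal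
too, so `∇G(df(y))` is proportional to `y` for generic and hence for all `y` in `X`, and `x` is
proportional to `∇G(F)` (`IsParametrizedBy.subsingleton_contactLocus`). Hence a contact locus with
`∇G(F) ≠ 0` has at most one point.

For the Chow variety, `φ` is the product of the forms `x_i + ∑ j ≠ i, a_ij x_j`, `i < d`. At `a =
0` the second derivative of `φ` in the parameters `a_ij` and `a_kl` is zero if `i = k` and the
monomial `x_j x_l ∏_{m ≠ i, k} x_m` if `i ≠ k`. A suitable `F` vanishing on the tangent space
takes on this monomial the value `1` if `j = l`, and `0` otherwise. The resulting matrix is block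
diagonal, and its blocks have zeros on the diagonal and ones elsewhere; they have size at least `d
- 1 ≥ 2` and are invertible (`det_hessian_chart_ne_zero`).
-/

noncomputable section

namespace MvPolynomial

/-! ### Polynomial relations -/

theorem exists_eval_ne_zero {σ : Type} {p : MvPolynomial σ ℂ} (hp : p ≠ 0) :
    ∃ x, eval x p ≠ 0 := by
  by_contra! h
  exact hp (MvPolynomial.funext fun x => by simpa using h x)

theorem totalDegree_pderiv_lt {σ : Type} {p : MvPolynomial σ ℂ} {i : σ} (h : pderiv i p ≠ 0) :
    (pderiv i p).totalDegree < p.totalDegree := by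
  classical
  have hpos : ∀ m ∈ (pderiv i p).support, m.degree + 1 ≤ p.totalDegree := by
    intro m hm
    rw [mem_support_iff, coeff_pderiv] at hm
    have h1 : m + Finsupp.single i 1 ∈ p.support :=
      mem_support_iff.2 (left_ne_zero_of_mul hm)
    have h2 := le_totalDegree h1
    have h3 : (m + Finsupp.single i 1).sum (fun _ e => e) = m.degree + 1 := by
      change (m + Finsupp.single i 1).degree = _
      rw [map_add, Finsupp.degree_single]
    omega
  obtain ⟨m, hm⟩ := Finset.nonempty_iff_ne_empty.2 (fun h0 => h (support_eq_empty.1 h0))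
  refine (Finset.sup_lt_iff ?_).2 ?_
  · exact lt_of_lt_of_le (by simp) (hpos m hm)
  · intro m hm
    have := hpos m hm
    change m.degree < _
    omega

theorem eq_C_of_pderiv_eq_zero {σ : Type} {p : MvPolynomial σ ℂ} (h : ∀ i, pderiv i p = 0) :
    p = C (coeff 0 p) := by
  classical
  ext m
  rw [coeff_C]
  split_ifs with hm
  · rw [hm]
  · obtain ⟨i, hi⟩ := Finsupp.ne_iff.1 (Ne.symm hm)
    have h1 := congrArg (coeff (m - Finsupp.single i 1)) (h i)
    have h2 : m - Finsupp.single i 1 + Finsupp.single i 1 = m :=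
      tsub_add_cancel_of_le (Finsupp.single_le_iff.2 (Nat.one_le_iff_ne_zero.2 hi))
    rw [coeff_pderiv, h2, coeff_zero, mul_eq_zero] at h1
    exact h1.resolve_right (by norm_cast)

/-- More polynomials than variables satisfy a relation, and a relation of least degree has a
partial derivative that is not a relation again. -/
theorem exists_relation {κ ι : Type} [Fintype κ] [Fintype ι]
    (h : Fintype.card κ < Fintype.card ι) (Ψ : ι → MvPolynomial κ ℂ) :
    ∃ G : MvPolynomial ι ℂ, bind₁ Ψ G = 0 ∧ ∃ α, bind₁ Ψ (pderiv α G) ≠ 0 := by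
  classical
  have hdep : ∃ G : MvPolynomial ι ℂ, bind₁ Ψ G = 0 ∧ G ≠ 0 := by
    by_contra! hc
    have hind : AlgebraicIndependent ℂ Ψ :=
      (injective_iff_map_eq_zero (bind₁ Ψ)).2 hc
    have := hind.cardinalMk_le_trdeg
    rw [MvPolynomial.trdeg_of_isDomain] at this
    simp only [Cardinal.mk_fintype, Cardinal.lift_natCast, Nat.cast_le] at this
    omega
  have hex : ∃ n, ∃ G : MvPolynomial ι ℂ, (bind₁ Ψ G = 0 ∧ G ≠ 0) ∧ G.totalDegree = n := by
    obtain ⟨G, hG⟩ := hdep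
    exact ⟨_, G, hG, rfl⟩
  obtain ⟨G, ⟨hG, hG0⟩, hdeg⟩ := Nat.find_spec hex
  refine ⟨G, hG, ?_⟩
  by_contra! hall
  have hz : ∀ i, pderiv i G = 0 := by
    intro i
    by_contra hne
    exact Nat.find_min hex (hdeg ▸ totalDegree_pderiv_lt hne) ⟨_, ⟨hall i, hne⟩, rfl⟩
  have hC := eq_C_of_pderiv_eq_zero hz
  rw [hC, bind₁_C_right] at hG
  rw [C_eq_zero] at hG
  exact hG0 (by rw [hC, hG, map_zero])

/-- Evaluation at a dual number point is the first order Taylor expansion. -/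
theorem aeval_dualNumber {σ : Type} [Fintype σ] (x y : σ → ℂ) (f : MvPolynomial σ ℂ) :
    aeval (fun i => (TrivSqZeroExt.inl (x i) + TrivSqZeroExt.inr (y i) : DualNumber ℂ)) f =
      TrivSqZeroExt.inl (eval x f) +
        TrivSqZeroExt.inr (∑ i, y i * eval x (pderiv i f)) := by
  classical
  induction f using MvPolynomial.induction_on with
  | C a =>
    ext <;> simp [TrivSqZeroExt.algebraMap_eq_inl]
  | add p q hp hq =>
    rw [map_add, hp, hq]
    ext <;> simp [mul_add, Finset.sum_add_distrib]
  | mul_X p j hp =>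
    rw [map_mul, hp, aeval_X]
    ext
    · simp
    · simp only [TrivSqZeroExt.snd_mul, TrivSqZeroExt.fst_add, TrivSqZeroExt.fst_inl,
        TrivSqZeroExt.fst_inr, TrivSqZeroExt.snd_add, TrivSqZeroExt.snd_inl,
        TrivSqZeroExt.snd_inr, pderiv_mul, pderiv_X, map_add, map_mul, eval_X, add_zero, zero_add,
        mul_add, Finset.sum_add_distrib, smul_eq_mul, MulOpposite.smul_eq_mul_unop,
        MulOpposite.unop_op]
      rw [Finset.sum_eq_single (s := Finset.univ) (f := fun i => y i * (eval x p * _)) j]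
      · simp only [Pi.single_eq_same, map_one, mul_one, Finset.sum_mul]
        rw [mul_comm (y j), add_comm]
        simp only [mul_comm, mul_left_comm]
        simp [add_comm]
      · intro b _ hb
        simp [Ne.symm hb]
      · simp

/-- The chain rule for polynomial maps. -/
theorem pderiv_bind₁ {κ ι : Type} [Fintype ι] (Ψ : ι → MvPolynomial κ ℂ) (G : MvPolynomial ι ℂ)
    (k : κ) : pderiv k (bind₁ Ψ G) = ∑ α, bind₁ Ψ (pderiv α G) * pderiv k (Ψ α) := by
  classical
  induction G using MvPolynomial.induction_on with
  | C a => simp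
  | add p q hp hq => simp only [map_add, hp, hq, add_mul, Finset.sum_add_distrib]
  | mul_X p j hp =>
    have h1 : ∀ α, bind₁ Ψ (pderiv α (p * X j)) * pderiv k (Ψ α) =
        bind₁ Ψ (pderiv α p) * pderiv k (Ψ α) * Ψ j +
          (if α = j then bind₁ Ψ p * pderiv k (Ψ j) else 0) := by
      intro α
      rw [pderiv_mul, map_add, map_mul, map_mul, bind₁_X_right, pderiv_X]
      split_ifs with h
      · subst h
        simp only [Pi.single_eq_same, map_one]
        ring
      · rw [Pi.single_eq_of_ne' h, map_zero]
        ring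
    rw [map_mul, bind₁_X_right, pderiv_mul, hp, Finset.sum_congr rfl fun α _ => h1 α,
      Finset.sum_add_distrib, Finset.sum_ite_eq', if_pos (Finset.mem_univ j), Finset.sum_mul]

end MvPolynomial

namespace ProjVar

open MvPolynomial

variable {ι σ : Type}

/-! ### Parametrized projective varieties -/

theorem ProjSpace.mk_coords (x : ProjSpace ι) : ProjSpace.mk x.coords x.rep_nonzero = x :=
  Projectivization.mk_rep x

theorem ProjSpace.exists_coords_mk (v : ι → ℂ) (hv : v ≠ 0) :
    ∃ c : ℂ, c ≠ 0 ∧ (ProjSpace.mk v hv).coords = c • v := by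
  obtain ⟨a, ha⟩ := Projectivization.exists_smul_eq_mk_rep ℂ v hv
  exact ⟨a, a.ne_zero, ha.symm⟩

theorem ProjSpace.mk_smul (v : ι → ℂ) (hv : v ≠ 0) (c : ℂ) (hcv : c • v ≠ 0) :
    ProjSpace.mk (c • v) hcv = ProjSpace.mk v hv :=
  (Projectivization.mk_eq_mk_iff' ℂ _ _ hcv hv).2 ⟨c, rfl⟩

theorem smul_mem_affineCone {X : Set (ProjSpace ι)} {v : ι → ℂ} (hv : v ∈ affineCone X) (c : ℂ) :
    c • v ∈ affineCone X := by
  intro hcv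
  have hv0 : v ≠ 0 := right_ne_zero_of_smul hcv
  rw [ProjSpace.mk_smul v hv0 c hcv]
  exact hv hv0

theorem coords_mem_affineCone {X : Set (ProjSpace ι)} {x : ProjSpace ι} (hx : x ∈ X) :
    x.coords ∈ affineCone X := fun _ => by
  rw [ProjSpace.mk_coords]
  exact hx

theorem ProjSpace.exists_basicOpen_subset {O : Set (ProjSpace ι)} (hO : IsOpen O)
    {x : ProjSpace ι} (hx : x ∈ O) :
    ∃ (k : ℕ) (f : MvPolynomial ι ℂ), f.IsHomogeneous k ∧ eval x.coords f ≠ 0 ∧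
      ProjSpace.basicOpen f ⊆ O := by
  induction hO with
  | basic U hU =>
    obtain ⟨k, f, hf, rfl⟩ := hU
    exact ⟨k, f, hf, hx, subset_rfl⟩
  | univ => exact ⟨0, 1, isHomogeneous_one _ _, by simp, Set.subset_univ _⟩
  | inter U V _ _ hU hV =>
    obtain ⟨k, f, hf, hfx, hfU⟩ := hU hx.1
    obtain ⟨l, g, hg, hgx, hgV⟩ := hV hx.2
    refine ⟨k + l, f * g, hf.mul hg, by simp [hfx, hgx], fun y hy => ?_⟩
    have hy' : eval y.coords f * eval y.coords g ≠ 0 := by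
      simpa [ProjSpace.basicOpen] using hy
    exact ⟨hfU (left_ne_zero_of_mul hy'), hgV (right_ne_zero_of_mul hy')⟩
  | sUnion S _ hS =>
    obtain ⟨U, hU, hxU⟩ := hx
    obtain ⟨k, f, hf, hfx, hfU⟩ := hS U hU hxU
    exact ⟨k, f, hf, hfx, hfU.trans (Set.subset_sUnion_of_mem hU)⟩

theorem ProjSpace.isOpen_basicOpen {k : ℕ} {f : MvPolynomial ι ℂ} (hf : f.IsHomogeneous k) :
    IsOpen (ProjSpace.basicOpen f) :=
  TopologicalSpace.isOpen_generateFrom_of_mem ⟨k, f, hf, rfl⟩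

theorem eval_smul_of_isHomogeneous {k : ℕ} {f : MvPolynomial ι ℂ} (hf : f.IsHomogeneous k)
    (c : ℂ) (v : ι → ℂ) : eval (c • v) f = c ^ k * eval v f := by
  rw [eval_eq, eval_eq, Finset.mul_sum]
  refine Finset.sum_congr rfl fun m hm => ?_
  have hm' : ∑ i ∈ m.support, m i = k := by
    exact (DFunLike.congr_fun (Finsupp.degree_eq_weight_one (R := ℕ)) m).trans
      (hf (mem_support_iff.1 hm))
  simp only [Pi.smul_apply, smul_eq_mul, mul_pow, Finset.prod_mul_distrib,
    Finset.prod_pow_eq_pow_sum, hm']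
  ring

/-- A polynomial vanishing along a line through the origin has all its homogeneous components
vanishing there. -/
theorem eval_homogeneousComponent_eq_zero {f : MvPolynomial ι ℂ} {v : ι → ℂ}
    (h : ∀ c : ℂ, eval (c • v) f = 0) (k : ℕ) : eval v (homogeneousComponent k f) = 0 := by
  have hsum : ∀ c : ℂ, eval (c • v) f =
      ∑ i ∈ Finset.range (f.totalDegree + 1), c ^ i * eval v (homogeneousComponent i f) := by
    intro c
    conv_lhs => rw [← sum_homogeneousComponent f, map_sum]
    exact Finset.sum_congr rfl fun i _ =>
      eval_smul_of_isHomogeneous (homogeneousComponent_isHomogeneous i f) c v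
  by_cases hk : k < f.totalDegree + 1
  · set q : Polynomial ℂ := ∑ i ∈ Finset.range (f.totalDegree + 1),
      Polynomial.C (eval v (homogeneousComponent i f)) * Polynomial.X ^ i with hq
    have hq0 : q = 0 := by
      refine Polynomial.funext fun c => ?_
      rw [hq, Polynomial.eval_finsetSum, Polynomial.eval_zero, ← h c, hsum c]
      exact Finset.sum_congr rfl fun i _ => by
        rw [Polynomial.eval_mul, Polynomial.eval_C, Polynomial.eval_pow, Polynomial.eval_X, mul_comm]
    have := congrArg (fun r => Polynomial.coeff r k) hq0
    simpa [hq, Polynomial.finsetSum_coeff, Polynomial.coeff_X_pow, hk, Nat.lt_succ_iff] using this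
  · rw [homogeneousComponent_eq_zero _ _ (by omega), map_zero]

/-- The value at `a` of the polynomial map with components `φ`. -/
def polyMap (φ : ι → MvPolynomial σ ℂ) (a : σ → ℂ) : ι → ℂ := fun α => eval a (φ α)

theorem eval_polyMap (φ : ι → MvPolynomial σ ℂ) (a : σ → ℂ) (f : MvPolynomial ι ℂ) :
    eval (polyMap φ a) f = eval a (bind₁ φ f) := by
  have := aeval_bind₁ (R := ℂ) (S := ℂ) a φ f
  simp only [← aeval_eq_eval] at *
  exact this.symm

/-- The variety `X` is the Zariski closure of the set of the points `[φ a]`, in the sense that it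
contains these points and satisfies every homogeneous equation that they satisfy. -/
structure IsParametrizedBy (X : Set (ProjSpace ι)) (φ : ι → MvPolynomial σ ℂ) : Prop where
  mk_mem : ∀ (a : σ → ℂ) (h : polyMap φ a ≠ 0), ProjSpace.mk (polyMap φ a) h ∈ X
  eval_coords : ∀ (k : ℕ) (f : MvPolynomial ι ℂ), f.IsHomogeneous k →
    (∀ a, eval (polyMap φ a) f = 0) → ∀ x ∈ X, eval x.coords f = 0

variable {X : Set (ProjSpace ι)} {φ : ι → MvPolynomial σ ℂ}

theorem IsParametrizedBy.smul_polyMap_mem (hX : IsParametrizedBy X φ) (c : ℂ) (a : σ → ℂ) :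
    c • polyMap φ a ∈ affineCone X :=
  smul_mem_affineCone (fun h => hX.mk_mem a h) c

/-- A polynomial belongs to the ideal of `X` as soon as it vanishes on the cone over the points
`[φ a]` for generic `a`. -/
theorem IsParametrizedBy.mem_vanishingIdeal (hX : IsParametrizedBy X φ) {f : MvPolynomial ι ℂ}
    {D : MvPolynomial σ ℂ} (hD : D ≠ 0)
    (h : ∀ a, eval a D ≠ 0 → ∀ c : ℂ, eval (c • polyMap φ a) f = 0) :
    f ∈ vanishingIdeal ℂ (affineCone X) := by
  have hall : ∀ (c : ℂ) (a : σ → ℂ), eval (c • polyMap φ a) f = 0 := by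
    intro c
    have hc : ∀ a, c • polyMap φ a = polyMap (fun α => C c * φ α) a := by
      intro a
      ext α
      simp [polyMap]
    have h0 : bind₁ (fun α => C c * φ α) f * D = 0 := by
      refine MvPolynomial.funext fun a => ?_
      rw [map_mul, ← eval_polyMap, ← hc, map_zero]
      by_cases ha : eval a D = 0
      · rw [ha, mul_zero]
      · rw [h a ha c, zero_mul]
    intro a
    rw [hc, eval_polyMap, (mul_eq_zero.1 h0).resolve_right hD, map_zero]
  rw [mem_vanishingIdeal_iff]
  intro v hv
  rw [aeval_eq_eval, ← sum_homogeneousComponent f]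
  simp only [map_sum]
  refine Finset.sum_eq_zero fun k _ => ?_
  have hk : ∀ x ∈ X, eval x.coords (homogeneousComponent k f) = 0 :=
    hX.eval_coords k _ (homogeneousComponent_isHomogeneous k f) fun a =>
      eval_homogeneousComponent_eq_zero (fun c => hall c a) k
  by_cases hv0 : v = 0
  · have h1 : eval v (homogeneousComponent k f) = eval ((0 : ℂ) • polyMap φ 0)
        (homogeneousComponent k f) := by rw [hv0, zero_smul]
    rw [h1]
    rw [eval_smul_of_isHomogeneous (homogeneousComponent_isHomogeneous k f),
      eval_homogeneousComponent_eq_zero (fun c => hall c 0) k, mul_zero]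
  · obtain ⟨c, hc, hcv⟩ := ProjSpace.exists_coords_mk v hv0
    have h1 := hk _ (hv hv0)
    rw [hcv, eval_smul_of_isHomogeneous (homogeneousComponent_isHomogeneous k f)] at h1
    exact (mul_eq_zero.1 h1).resolve_left (pow_ne_zero _ hc)

/-- The point `[φ a]` lies in a given nonempty open subset of `X` for generic `a`. -/
theorem IsParametrizedBy.exists_mk_mem (hX : IsParametrizedBy X φ) {O : Set (ProjSpace ι)}
    (hO : IsOpen O) {x : ProjSpace ι} (hx : x ∈ X) (hxO : x ∈ O) :
    ∃ D : MvPolynomial σ ℂ, D ≠ 0 ∧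
      ∀ a, eval a D ≠ 0 → ∀ h : polyMap φ a ≠ 0, ProjSpace.mk (polyMap φ a) h ∈ O := by
  obtain ⟨k, f, hf, hfx, hfO⟩ := ProjSpace.exists_basicOpen_subset hO hxO
  refine ⟨bind₁ φ f, fun h0 => hfx (hX.eval_coords k f hf (fun a => ?_) x hx), fun a ha h => ?_⟩
  · rw [eval_polyMap, h0, map_zero]
  · apply hfO
    obtain ⟨c, hc, hcv⟩ := ProjSpace.exists_coords_mk _ h
    change eval _ f ≠ 0
    rw [hcv, eval_smul_of_isHomogeneous hf, eval_polyMap]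
    exact mul_ne_zero (pow_ne_zero _ hc) ha

variable [Fintype ι]

theorem differential_apply (f : MvPolynomial ι ℂ) (v u : ι → ℂ) :
    differential f v u = ∑ i, eval v (pderiv i f) * u i := by
  simp [differential]

theorem mem_tangentSpace {x : ProjSpace ι} {u : ι → ℂ} :
    u ∈ tangentSpace X x ↔
      ∀ f ∈ vanishingIdeal ℂ (affineCone X), ∑ i, eval x.coords (pderiv i f) * u i = 0 := by
  simp [tangentSpace, Submodule.mem_iInf, differential_apply]

theorem mem_hyperplane {h : ProjSpace ι} {u : ι → ℂ} :
    u ∈ hyperplane h ↔ ∑ i, h.coords i * u i = 0 := by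
  simp [hyperplane]

theorem sum_pderiv_smul_eq_zero {v u : ι → ℂ} {c : ℂ} (hc : c ≠ 0)
    (h : ∀ f ∈ vanishingIdeal ℂ (affineCone X), ∑ i, eval v (pderiv i f) * u i = 0) :
    ∀ f ∈ vanishingIdeal ℂ (affineCone X), ∑ i, eval (c • v) (pderiv i f) * u i = 0 := by
  classical
  intro f hf
  have hpt : ∀ w : ι → ℂ, polyMap (fun i => C c * MvPolynomial.X i) w = c • w := by
    intro w
    ext i
    simp [polyMap]
  have hfc : bind₁ (fun i => C c * MvPolynomial.X i) f ∈ vanishingIdeal ℂ (affineCone X) := by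
    rw [mem_vanishingIdeal_iff] at hf ⊢
    intro w hw
    have := hf (c • w) (smul_mem_affineCone hw c)
    rw [aeval_eq_eval] at this ⊢
    rwa [← eval_polyMap, hpt]
  have h1 := h _ hfc
  have h2 : ∀ i, eval v (pderiv i (bind₁ (fun i => C c * MvPolynomial.X i) f)) =
      c * eval (c • v) (pderiv i f) := by
    intro i
    rw [pderiv_bind₁, map_sum, Finset.sum_eq_single i]
    · rw [map_mul, ← eval_polyMap, hpt, pderiv_C_mul, pderiv_X_self]
      simp [mul_comm]
    · intro j _ hj
      rw [pderiv_C_mul, pderiv_X_of_ne hj]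
      simp
    · simp
  simp only [h2, mul_assoc, ← Finset.mul_sum] at h1
  exact (mul_eq_zero.1 h1).resolve_left hc

theorem mem_tangentSpace_mk {v u : ι → ℂ} (hv : v ≠ 0) :
    u ∈ tangentSpace X (ProjSpace.mk v hv) ↔
      ∀ f ∈ vanishingIdeal ℂ (affineCone X), ∑ i, eval v (pderiv i f) * u i = 0 := by
  obtain ⟨c, hc, hcv⟩ := ProjSpace.exists_coords_mk v hv
  rw [mem_tangentSpace, hcv]
  refine ⟨fun h => ?_, sum_pderiv_smul_eq_zero hc⟩
  have := sum_pderiv_smul_eq_zero (inv_ne_zero hc) h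
  rwa [inv_smul_smul₀ hc] at this

/-- A hyperplane tangent to `X` at `x` is cut out by the differential at `x` of a single element
of the ideal of `X`. -/
theorem exists_eq_pderiv_of_tangentSpace_le {x h : ProjSpace ι}
    (hle : tangentSpace X x ≤ hyperplane h) :
    ∃ f ∈ vanishingIdeal ℂ (affineCone X), ∀ i, h.coords i = eval x.coords (pderiv i f) := by
  classical
  let W : Submodule ℂ (ι → ℂ) :=
    { carrier := {w | ∃ f ∈ vanishingIdeal ℂ (affineCone X), ∀ i, w i = eval x.coords (pderiv i f)}
      add_mem' := by
        rintro _ _ ⟨f, hf, hf'⟩ ⟨g, hg, hg'⟩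
        exact ⟨f + g, add_mem hf hg, fun i => by simp [hf', hg']⟩
      zero_mem' := ⟨0, zero_mem _, by simp⟩
      smul_mem' := by
        rintro c _ ⟨f, hf, hf'⟩
        exact ⟨C c * f, Ideal.mul_mem_left _ _ hf, fun i => by simp [hf']⟩ }
  suffices hW : h.coords ∈ W from hW
  by_contra hnot
  obtain ⟨φ, hφ, hφW⟩ := Submodule.exists_le_ker_of_notMem hnot
  have hrep : ∀ w : ι → ℂ, φ w = ∑ i, w i * φ (Pi.single i 1) := by
    intro w
    conv_lhs => rw [pi_eq_sum_univ' w, map_sum]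
    simp
  apply hφ
  rw [hrep]
  refine mem_hyperplane.1 (hle (mem_tangentSpace.2 fun f hf => ?_))
  rw [← hrep fun i => eval x.coords (pderiv i f)]
  exact hφW ⟨f, hf, fun i => rfl⟩

end ProjVar

namespace ProjVar

open MvPolynomial

/-! ### Solving linear systems with polynomial coefficients -/

section Solve

variable {ι κ : Type} {R R' : Type} [Fintype κ] [DecidableEq ι] [CommRing R] [CommRing R']

/-- The vector supported on the range of `τ` with given entries there. -/
def extendZero (τ : κ → ι) (w : κ → R) (α : ι) : R := ∑ l, if τ l = α then w l else 0

theorem sum_mul_extendZero [Fintype ι] (τ : κ → ι) (c : ι → R) (w : κ → R) :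
    ∑ α, c α * extendZero τ w α = ∑ l, c (τ l) * w l := by
  simp only [extendZero, Finset.mul_sum, mul_ite, mul_zero]
  rw [Finset.sum_comm]
  simp

theorem extendZero_apply [DecidableEq κ] {τ : κ → ι} (hτ : Function.Injective τ) (w : κ → R) (l : κ) :
    extendZero τ w (τ l) = w l := by
  simp [extendZero, hτ.eq_iff]

theorem extendZero_of_notMem {τ : κ → ι} (w : κ → R) {α : ι} (hα : α ∉ Set.range τ) :
    extendZero τ w α = 0 :=
  Finset.sum_eq_zero fun l _ => if_neg fun h => hα ⟨l, h⟩

/-- The square submatrix of `J` with the columns `τ`. -/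
def minorMatrix (J : κ → ι → R) (τ : κ → ι) : Matrix κ κ R := Matrix.of fun k l => J k (τ l)

variable [Fintype ι] [DecidableEq κ]

/-- Cramer's rule without denominators: the solution of `J F = 0` whose entries outside the columns
`τ` are those of `u`, multiplied by the minor of `J` on these columns. -/
def cramerSolution (J : κ → ι → R) (τ : κ → ι) (u : ι → R) (α : ι) : R :=
  (minorMatrix J τ).det * u α -
    extendZero τ ((minorMatrix J τ).adjugate.mulVec fun k => ∑ β, J k β * u β) α

theorem sum_mul_cramerSolution (J : κ → ι → R) (τ : κ → ι) (u : ι → R) (k : κ) :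
    ∑ α, J k α * cramerSolution J τ u α = 0 := by
  simp only [cramerSolution, mul_sub, Finset.sum_sub_distrib]
  rw [sum_mul_extendZero]
  have h := congrFun (Matrix.mulVec_mulVec (fun k => ∑ β, J k β * u β) (minorMatrix J τ)
    (minorMatrix J τ).adjugate) k
  rw [Matrix.mul_adjugate, Matrix.smul_mulVec, Matrix.one_mulVec] at h
  change ∑ l, J k (τ l) * _ = _ at h
  rw [h, Pi.smul_apply, smul_eq_mul, Finset.mul_sum, sub_eq_zero]
  exact Finset.sum_congr rfl fun α _ => by ring

theorem cramerSolution_eq {J : κ → ι → R} {τ : κ → ι} (hτ : Function.Injective τ) {u F : ι → R}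
    (hF : ∀ k, ∑ α, J k α * F α = 0) (hu : ∀ l, u (τ l) = 0)
    (huF : ∀ α, α ∉ Set.range τ → u α = F α) (α : ι) :
    cramerSolution J τ u α = (minorMatrix J τ).det * F α := by
  have hu' : ∀ β, u β = F β - extendZero τ (fun l => F (τ l)) β := by
    intro β
    by_cases hβ : β ∈ Set.range τ
    · obtain ⟨l, rfl⟩ := hβ
      rw [extendZero_apply hτ, hu, sub_self]
    · rw [extendZero_of_notMem _ hβ, sub_zero, huF β hβ]
  have hJu : (fun k => ∑ β, J k β * u β) =
      -((minorMatrix J τ).mulVec fun l => F (τ l)) := by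
    ext k
    simp only [hu', mul_sub, Finset.sum_sub_distrib]
    rw [hF, sum_mul_extendZero, zero_sub]
    rfl
  rw [cramerSolution, hJu, Matrix.mulVec_neg, Matrix.mulVec_mulVec, Matrix.adjugate_mul,
    Matrix.smul_mulVec, Matrix.one_mulVec]
  by_cases hα : α ∈ Set.range τ
  · obtain ⟨l, rfl⟩ := hα
    rw [extendZero_apply hτ, hu]
    simp
  · rw [extendZero_of_notMem _ hα, huF α hα, sub_zero]

theorem map_cramerSolution (f : R →+* R') (J : κ → ι → R) (τ : κ → ι) (u : ι → R) (α : ι) :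
    f (cramerSolution J τ u α) =
      cramerSolution (fun k β => f (J k β)) τ (fun β => f (u β)) α := by
  have hB : minorMatrix (fun k β => f (J k β)) τ = f.mapMatrix (minorMatrix J τ) := rfl
  have hdet : (minorMatrix (fun k β => f (J k β)) τ).det = f (minorMatrix J τ).det := by
    rw [hB, RingHom.map_det]
  have hadj : ∀ k l, (minorMatrix (fun k β => f (J k β)) τ).adjugate k l =
      f ((minorMatrix J τ).adjugate k l) := fun k l => by
    rw [hB, ← RingHom.map_adjugate]
    rfl
  simp only [cramerSolution, hdet, map_sub, map_mul, extendZero, map_sum, Matrix.mulVec,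
    dotProduct, hadj]
  congr 1
  refine Finset.sum_congr rfl fun l _ => ?_
  split_ifs <;> simp only [map_sum, map_mul, map_zero]

end Solve

variable {ι σ : Type}

/-! ### The first order jet of a parametrization -/

/-- The matrix whose rows are `φ` and its partial derivatives. At a generic point `a`, its rows
span the tangent space at `[φ a]` of the variety parametrized by `φ`. -/
def jet (φ : ι → MvPolynomial σ ℂ) : Option σ → ι → MvPolynomial σ ℂ
  | none, α => φ α
  | some k, α => pderiv k (φ α)

/-- The parametrization of the affine cone by `(c, a) ↦ c • φ a`, the variable `none` standing
for `c`. -/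
def coneMap (φ : ι → MvPolynomial σ ℂ) (α : ι) : MvPolynomial (Option σ) ℂ :=
  X none * rename some (φ α)

theorem eval_coneMap (φ : ι → MvPolynomial σ ℂ) (c : ℂ) (a : σ → ℂ) :
    polyMap (coneMap φ) (fun o => o.elim c a) = c • polyMap φ a := by
  ext α
  simp [polyMap, coneMap, eval_rename, Function.comp_def]

theorem pderiv_coneMap_none (φ : ι → MvPolynomial σ ℂ) (α : ι) :
    pderiv none (coneMap φ α) = rename some (jet φ none α) := by
  classical
  have h : pderiv none (rename (some : σ → Option σ) (φ α)) = 0 := by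
    refine pderiv_eq_zero_of_notMem_vars fun hm => ?_
    obtain ⟨k, _, hk⟩ := Finset.mem_image.1 (vars_rename _ _ hm)
    exact Option.some_ne_none k hk
  rw [coneMap, pderiv_mul, h, pderiv_X_self]
  simp [jet]

theorem pderiv_coneMap_some (φ : ι → MvPolynomial σ ℂ) (α : ι) (k : σ) :
    pderiv (some k) (coneMap φ α) = X none * rename some (jet φ (some k) α) := by
  rw [coneMap, pderiv_mul, pderiv_rename (Option.some_injective σ), pderiv_X_of_ne (by simp)]
  simp [jet]

variable {X : Set (ProjSpace ι)} {φ : ι → MvPolynomial σ ℂ}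

theorem IsParametrizedBy.bind₁_coneMap (hX : IsParametrizedBy X φ) {f : MvPolynomial ι ℂ}
    (hf : f ∈ vanishingIdeal ℂ (affineCone X)) : bind₁ (coneMap φ) f = 0 := by
  refine MvPolynomial.funext fun x => ?_
  have hx : x = fun o : Option σ => o.elim (x none) (fun k => x (some k)) := by
    ext o
    cases o <;> rfl
  rw [← eval_polyMap, hx, eval_coneMap, map_zero]
  have := (mem_vanishingIdeal_iff.1 hf) _
    (hX.smul_polyMap_mem (x none) (fun k => x (some k)))
  rwa [aeval_eq_eval] at this

variable [Fintype ι]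

theorem IsParametrizedBy.sum_pderiv_mul_jet (hX : IsParametrizedBy X φ) {f : MvPolynomial ι ℂ}
    (hf : f ∈ vanishingIdeal ℂ (affineCone X)) (c : ℂ) (a : σ → ℂ) (k : Option σ) :
    c * ∑ α, eval (c • polyMap φ a) (pderiv α f) * eval a (jet φ k α) = 0 := by
  have h := congrArg (fun p => eval (fun o : Option σ => o.elim c a) (pderiv k p))
    (hX.bind₁_coneMap hf)
  simp only [pderiv_bind₁, map_sum, map_mul, ← eval_polyMap, eval_coneMap, map_zero] at h
  cases k with
  | none =>
    simp only [pderiv_coneMap_none, eval_rename, Function.comp_def, Option.elim_some] at h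
    rw [h, mul_zero]
  | some k =>
    simp only [pderiv_coneMap_some, map_mul, eval_X, eval_rename, Function.comp_def,
      Option.elim_some, Option.elim_none] at h
    rw [Finset.mul_sum, ← h]
    exact Finset.sum_congr rfl fun _ _ => by ring

variable [Fintype σ] [DecidableEq ι] [DecidableEq σ]

/-- The coordinate `s` of the cone is algebraic over the coordinates `τ`: a relation between them
provides an equation of `X` that involves only these coordinates and whose derivative with respect
to the coordinate `s` is generically nonzero. -/
theorem IsParametrizedBy.exists_equation (hX : IsParametrizedBy X φ) {τ : Option σ → ι}
    (hτ : Function.Injective τ) (hδ : (minorMatrix (jet φ) τ).det ≠ 0) {s : ι}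
    (hs : s ∉ Set.range τ) :
    ∃ f ∈ vanishingIdeal ℂ (affineCone X), ∃ (c : ℂ) (D : MvPolynomial σ ℂ), c ≠ 0 ∧ D ≠ 0 ∧
      (∀ α, α ≠ s → α ∉ Set.range τ → pderiv α f = 0) ∧
      ∀ a, eval a D ≠ 0 → eval (c • polyMap φ a) (pderiv s f) ≠ 0 := by
  let idx : Option (Option σ) → ι := fun o => o.elim s τ
  have hidx : Function.Injective idx := by
    rintro (_ | l) (_ | l') h
    · rfl
    · exact absurd ⟨l', h.symm⟩ hs
    · exact absurd ⟨l, h⟩ hs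
    · exact congrArg some (hτ h)
  obtain ⟨f₀, hf₀, o₀, ho₀⟩ := exists_relation (κ := Option σ) (ι := Option (Option σ))
    (by simp) (fun o => coneMap φ (idx o))
  have hbind : ∀ g, bind₁ (coneMap φ) (rename idx g) = bind₁ (fun o => coneMap φ (idx o)) g :=
    fun g => bind₁_rename _ _ _
  set f := rename idx f₀ with hf_def
  have hf : bind₁ (coneMap φ) f = 0 := by rw [hf_def, hbind, hf₀]
  have hpd : ∀ o, pderiv (idx o) f = rename idx (pderiv o f₀) := fun o =>
    pderiv_rename hidx o f₀
  have hpd0 : ∀ α, α ≠ s → α ∉ Set.range τ → pderiv α f = 0 := by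
    intro α hαs hατ
    refine pderiv_eq_zero_of_notMem_vars fun hm => ?_
    obtain ⟨o, _, ho⟩ := Finset.mem_image.1 (vars_rename _ _ hm)
    cases o with
    | none => exact hαs ho.symm
    | some l => exact hατ ⟨l, ho⟩
  have hes : bind₁ (coneMap φ) (pderiv s f) ≠ 0 := by
    intro hes
    -- otherwise the relation would be one between the independent coordinates `τ`
    have hrow : ∀ k, ∑ l, rename some (jet φ k (τ l)) * bind₁ (coneMap φ) (pderiv (τ l) f) = 0 := by
      intro k
      have h := congrArg (pderiv k) hf
      rw [pderiv_bind₁, map_zero] at h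
      have hsum : ∀ g : ι → MvPolynomial (Option σ) ℂ,
          ∑ α, bind₁ (coneMap φ) (pderiv α f) * g α =
            ∑ l, bind₁ (coneMap φ) (pderiv (τ l) f) * g (τ l) := by
        intro g
        refine (Finset.sum_of_injOn τ hτ.injOn (by simp) (fun α _ hα => ?_) (fun _ _ => rfl)).symm
        by_cases hαs : α = s
        · rw [hαs, hes, zero_mul]
        · rw [hpd0 α hαs (by simpa using hα), map_zero, zero_mul]
      rw [hsum] at h
      cases k with
      | none =>
        simp only [pderiv_coneMap_none] at h
        rw [← h]
        exact Finset.sum_congr rfl fun _ _ => mul_comm _ _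
      | some k =>
        simp only [pderiv_coneMap_some] at h
        refine (mul_eq_zero_iff_left (X_ne_zero (none : Option σ))).1 ?_
        rw [Finset.mul_sum, ← h]
        exact Finset.sum_congr rfl fun _ _ => by ring
    have hdet : ((rename (R := ℂ) (some : σ → Option σ)).toRingHom.mapMatrix
        (minorMatrix (jet φ) τ)).det ≠ 0 := by
      rw [← RingHom.map_det]
      exact fun h => hδ (rename_injective _ (Option.some_injective σ) (h.trans (map_zero _).symm))
    have hzero := Matrix.eq_zero_of_mulVec_eq_zero hdet
      (v := fun l => bind₁ (coneMap φ) (pderiv (τ l) f)) (funext hrow)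
    apply ho₀
    rw [← hbind, ← hpd]
    cases o₀ with
    | none => exact hes
    | some l => exact congrFun hzero l
  obtain ⟨x, hx⟩ := exists_eval_ne_zero (mul_ne_zero (X_ne_zero (R := ℂ) (none : Option σ)) hes)
  rw [map_mul, eval_X] at hx
  have hD : ∀ a, eval a (bind₁ (fun o : Option σ => o.elim (C (x none)) MvPolynomial.X)
      (bind₁ (coneMap φ) (pderiv s f))) = eval (x none • polyMap φ a) (pderiv s f) := by
    intro a
    rw [← eval_coneMap, eval_polyMap, ← eval_polyMap]
    congr 2
    ext o
    cases o <;> simp [polyMap]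
  refine ⟨f, hX.mem_vanishingIdeal one_ne_zero fun a _ c => ?_, x none, _, left_ne_zero_of_mul hx,
    fun h0 => right_ne_zero_of_mul hx ?_, hpd0, fun a ha => (hD a).symm ▸ ha⟩
  · rw [← eval_coneMap, eval_polyMap, hf, map_zero]
  · have h1 := hD fun k => x (some k)
    rw [h0, map_zero, ← eval_coneMap, eval_polyMap] at h1
    rw [h1]
    congr 2
    ext o
    cases o <;> rfl

/-- At the point `[φ a]`, for generic `a`, the linear forms vanishing on the tangent space to `X`
are the solutions of the linear system with matrix `jet φ`. -/
theorem IsParametrizedBy.exists_tangentSpace (hX : IsParametrizedBy X φ) {τ : Option σ → ι}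
    (hτ : Function.Injective τ) (hδ : (minorMatrix (jet φ) τ).det ≠ 0) :
    ∃ D : MvPolynomial σ ℂ, D ≠ 0 ∧ ∀ a, eval a D ≠ 0 → ∀ (ha : polyMap φ a ≠ 0) (F : ι → ℂ),
      (∀ u ∈ tangentSpace X (ProjSpace.mk _ ha), ∑ α, F α * u α = 0) ↔
        ∀ k, ∑ α, eval a (jet φ k α) * F α = 0 := by
  choose f hf c D hc hD hf0 hfD using fun s : {s // s ∉ Set.range τ} =>
    hX.exists_equation hτ hδ s.2
  refine ⟨(minorMatrix (jet φ) τ).det * ∏ s, D s,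
    mul_ne_zero hδ (Finset.prod_ne_zero_iff.2 fun s _ => hD s), fun a haD ha F => ?_⟩
  rw [map_mul, map_prod] at haD
  have hmem : ∀ k, (fun α => eval a (jet φ k α)) ∈ tangentSpace X (ProjSpace.mk _ ha) := by
    intro k
    rw [mem_tangentSpace_mk]
    intro g hg
    simpa using hX.sum_pderiv_mul_jet hg 1 a k
  refine ⟨fun h k => ?_, fun h u hu => ?_⟩
  · rw [← h _ (hmem k)]
    exact Finset.sum_congr rfl fun _ _ => mul_comm _ _
  · -- subtract from `u` the combination of rows with the same coordinates `τ`
    set B : Matrix (Option σ) (Option σ) ℂ := minorMatrix (fun k α => eval a (jet φ k α)) τ with hB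
    have hBdet : IsUnit B.det := by
      have : B.det = eval a (minorMatrix (jet φ) τ).det := by
        rw [RingHom.map_det]
        rfl
      rw [this]
      exact (left_ne_zero_of_mul haD).isUnit
    set z : Option σ → ℂ := Matrix.vecMul (fun l => u (τ l)) B⁻¹ with hz
    have hzB : ∀ l, ∑ k, z k * eval a (jet φ k (τ l)) = u (τ l) := by
      intro l
      have : Matrix.vecMul z B l = u (τ l) := by
        rw [hz, Matrix.vecMul_vecMul, Matrix.nonsing_inv_mul _ hBdet, Matrix.vecMul_one]
      exact this
    set v : ι → ℂ := u - ∑ k, z k • fun α => eval a (jet φ k α) with hv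
    have hvT : v ∈ tangentSpace X (ProjSpace.mk _ ha) :=
      sub_mem hu (sum_mem fun k _ => Submodule.smul_mem _ _ (hmem k))
    have hvτ : ∀ l, v (τ l) = 0 := by
      intro l
      rw [hv, Pi.sub_apply, Finset.sum_apply]
      simp only [Pi.smul_apply, smul_eq_mul, hzB, sub_self]
    have hv0 : ∀ α, v α = 0 := by
      intro s
      by_cases hs : s ∈ Set.range τ
      · obtain ⟨l, rfl⟩ := hs
        exact hvτ l
      · have hvs := hvT
        rw [← ProjSpace.mk_smul _ ha (c ⟨s, hs⟩) (smul_ne_zero (hc _) ha),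
          mem_tangentSpace_mk] at hvs
        have h1 := hvs _ (hf ⟨s, hs⟩)
        rw [Finset.sum_eq_single s] at h1
        · refine (mul_eq_zero.1 h1).resolve_left (hfD ⟨s, hs⟩ a ?_)
          exact Finset.prod_ne_zero_iff.1 (right_ne_zero_of_mul haD) _ (Finset.mem_univ _)
        · intro α _ hαs
          by_cases hα : α ∈ Set.range τ
          · obtain ⟨l, rfl⟩ := hα
            rw [hvτ, mul_zero]
          · rw [hf0 ⟨s, hs⟩ α hαs hα, map_zero, zero_mul]
        · simp
    have hu' : ∀ α, u α = ∑ k, z k * eval a (jet φ k α) := by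
      intro α
      have := hv0 α
      rw [hv, Pi.sub_apply, Finset.sum_apply, sub_eq_zero] at this
      exact this
    simp only [hu', Finset.mul_sum]
    rw [Finset.sum_comm]
    refine Finset.sum_eq_zero fun k _ => ?_
    rw [← mul_zero (z k), ← h k, Finset.mul_sum]
    exact Finset.sum_congr rfl fun _ _ => by ring

end ProjVar

namespace ProjVar

open MvPolynomial

variable {ι σ : Type}

/-! ### The dual variety and reflexivity -/

/-- The second fundamental form in the direction of the linear form `F`. -/
def hessian [Fintype ι] (φ : ι → MvPolynomial σ ℂ) (F : ι → ℂ) (a : σ → ℂ) : Matrix σ σ ℂ :=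
  Matrix.of fun k l => ∑ α, eval a (pderiv l (pderiv k (φ α))) * F α

theorem aeval_det_minorMatrix [Fintype σ] [DecidableEq σ] {R : Type} [CommRing R] [Algebra ℂ R]
    (φ : ι → MvPolynomial σ ℂ) (τ : Option σ → ι) (a : σ → R) :
    (minorMatrix (fun k β => aeval a (jet φ k β)) τ).det =
      aeval a (minorMatrix (jet φ) τ).det := by
  have := RingHom.map_det (aeval (R := ℂ) a).toRingHom (minorMatrix (jet φ) τ)
  exact this.symm

variable [Fintype ι] [Fintype σ] [DecidableEq ι] [DecidableEq σ]

/-- The parametrization of the conormal variety: the variables `Sum.inl k` are the parameters of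
the point of the variety, the variables `Sum.inr s` are the coordinates outside `τ` of a linear form
vanishing on the tangent space, and the remaining coordinates of this form are found by Cramer's
rule. -/
def conormalMap (φ : ι → MvPolynomial σ ℂ) (τ : Option σ → ι) :
    ι → MvPolynomial (σ ⊕ {s // s ∉ Set.range τ}) ℂ :=
  cramerSolution (fun k β => rename Sum.inl (jet φ k β)) τ
    (fun β => if h : β ∈ Set.range τ then 0 else X (Sum.inr ⟨β, h⟩))

theorem aeval_conormalMap {R : Type} [CommRing R] [Algebra ℂ R] (φ : ι → MvPolynomial σ ℂ)
    (τ : Option σ → ι) (a : σ → R) (u : {s // s ∉ Set.range τ} → R) (α : ι) :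
    aeval (Sum.elim a u) (conormalMap φ τ α) =
      cramerSolution (fun k β => aeval a (jet φ k β)) τ
        (fun β => if h : β ∈ Set.range τ then 0 else u ⟨β, h⟩) α := by
  have h := map_cramerSolution (aeval (R := ℂ) (Sum.elim a u)).toRingHom
    (fun k β => rename Sum.inl (jet φ k β)) τ
    (fun β => if h : β ∈ Set.range τ then 0 else X (Sum.inr ⟨β, h⟩)) α
  refine h.trans ?_
  congr 1
  · ext k β
    exact (aeval_rename _ _ _).trans rfl
  · ext β
    split_ifs with hβ
    · exact map_zero _
    · exact aeval_X _ _

/-- Where the chosen minor is invertible, the conormal variety is the image of its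
parametrization. -/
theorem exists_aeval_conormalMap {R : Type} [CommRing R] [Algebra ℂ R] {φ : ι → MvPolynomial σ ℂ}
    {τ : Option σ → ι} (hτ : Function.Injective τ) {a : σ → R} {F : ι → R}
    (hF : ∀ k, ∑ α, aeval a (jet φ k α) * F α = 0)
    (hδ : IsUnit (aeval a (minorMatrix (jet φ) τ).det)) :
    ∃ u : {s // s ∉ Set.range τ} → R,
      ∀ α, aeval (Sum.elim a u) (conormalMap φ τ α) = F α := by
  obtain ⟨d, hd⟩ := hδ
  refine ⟨fun s => ↑d⁻¹ * F s, fun α => ?_⟩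
  rw [aeval_conormalMap, cramerSolution_eq hτ (F := fun β => ↑d⁻¹ * F β),
    aeval_det_minorMatrix, ← hd, Units.mul_inv_cancel_left]
  · intro k
    rw [← mul_zero (↑d⁻¹ : R), ← hF k, Finset.mul_sum]
    exact Finset.sum_congr rfl fun _ _ => by ring
  · exact fun l => dif_pos ⟨l, rfl⟩
  · exact fun α hα => dif_neg hα

theorem sum_jet_mul_conormalMap (φ : ι → MvPolynomial σ ℂ) (τ : Option σ → ι) (a : σ → ℂ)
    (u : {s // s ∉ Set.range τ} → ℂ) (k : Option σ) :
    ∑ α, eval a (jet φ k α) * polyMap (conormalMap φ τ) (Sum.elim a u) α = 0 := by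
  have h : ∀ α, polyMap (conormalMap φ τ) (Sum.elim a u) α =
      cramerSolution (fun k β => aeval a (jet φ k β)) τ
        (fun β => if h : β ∈ Set.range τ then 0 else u ⟨β, h⟩) α :=
    fun α => aeval_conormalMap (R := ℂ) φ τ a u α
  simp only [h]
  exact sum_mul_cramerSolution (fun k β => aeval (S₁ := ℂ) a (jet φ k β)) τ _ k

/-- The conormal variety has dimension one less than the dual space, so the dual variety satisfies
a nontrivial equation. -/
theorem exists_dual_equation (φ : ι → MvPolynomial σ ℂ) {τ : Option σ → ι}
    (hτ : Function.Injective τ) :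
    ∃ G : MvPolynomial ι ℂ, bind₁ (conormalMap φ τ) G = 0 ∧
      ∃ α, bind₁ (conormalMap φ τ) (pderiv α G) ≠ 0 := by
  classical
  refine exists_relation ?_ _
  have h1 : Fintype.card {s // s ∉ Set.range τ} =
      Fintype.card ι - Fintype.card (Set.range τ) := Fintype.card_subtype_compl _
  have h2 : Fintype.card (Set.range τ) = Fintype.card σ + 1 := by
    rw [Set.card_range_of_injective hτ, Fintype.card_option]
  have h3 : Fintype.card (Set.range τ) ≤ Fintype.card ι := Fintype.card_subtype_le _
  rw [Fintype.card_sum, h1, h2]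
  omega

variable {φ : ι → MvPolynomial σ ℂ} {τ : Option σ → ι} {G : MvPolynomial ι ℂ}

/-- The gradient of an equation of the dual variety vanishes on the tangent vectors of the dual
variety coming from tangent vectors `(a', F')` of the conormal variety. -/
theorem sum_mul_pderiv_eq_zero (hτ : Function.Injective τ) (hG : bind₁ (conormalMap φ τ) G = 0)
    {a a' : σ → ℂ} {F F' : ι → ℂ} (hδ : eval a (minorMatrix (jet φ) τ).det ≠ 0)
    (hF : ∀ k, ∑ α, eval a (jet φ k α) * F α = 0)
    (hF' : ∀ k, ∑ α, (eval a (jet φ k α) * F' α +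
      (∑ l, a' l * eval a (pderiv l (jet φ k α))) * F α) = 0) :
    ∑ α, F' α * eval F (pderiv α G) = 0 := by
  have hker : ∀ k, ∑ α, aeval (fun i => (TrivSqZeroExt.inl (a i) + TrivSqZeroExt.inr (a' i) :
      DualNumber ℂ)) (jet φ k α) * (TrivSqZeroExt.inl (F α) + TrivSqZeroExt.inr (F' α)) = 0 := by
    intro k
    simp only [aeval_dualNumber]
    ext
    · simpa [TrivSqZeroExt.fst_sum] using hF k
    · rw [TrivSqZeroExt.snd_sum, TrivSqZeroExt.snd_zero, ← hF' k]
      refine Finset.sum_congr rfl fun α _ => ?_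
      simp
  obtain ⟨u, hu⟩ := exists_aeval_conormalMap hτ hker (by
    rw [TrivSqZeroExt.isUnit_iff_isUnit_fst, aeval_dualNumber]
    simpa using hδ)
  have h := congrArg (aeval (Sum.elim (fun i => (TrivSqZeroExt.inl (a i) +
    TrivSqZeroExt.inr (a' i) : DualNumber ℂ)) u)) hG
  rw [aeval_bind₁, map_zero, funext hu, aeval_dualNumber] at h
  simpa using congrArg TrivSqZeroExt.snd h

/-- Reflexivity at a point of the conormal variety where the second fundamental form is
nondegenerate: the gradient at `F` of an equation of the dual variety is proportional to the point
at which the hyperplane `F` is tangent. -/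
theorem exists_pderiv_eq_smul (hτ : Function.Injective τ) (hG : bind₁ (conormalMap φ τ) G = 0)
    {a : σ → ℂ} {F : ι → ℂ} (hδ : eval a (minorMatrix (jet φ) τ).det ≠ 0)
    (hF : ∀ k, ∑ α, eval a (jet φ k α) * F α = 0) (hQ : (hessian φ F a).det ≠ 0) :
    ∃ c : ℂ, ∀ α, eval F (pderiv α G) = c * polyMap φ a α := by
  have hrow : (fun α => eval F (pderiv α G)) ∈
      Submodule.span ℂ (Set.range fun k α => eval a (jet φ k α)) := by
    -- the gradient vanishes on the linear forms tangent at the same point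
    by_contra hnot
    obtain ⟨ψ, hψ, hψW⟩ := Submodule.exists_le_ker_of_notMem hnot
    have hrep : ∀ w : ι → ℂ, ψ w = ∑ i, w i * ψ (Pi.single i 1) := by
      intro w
      conv_lhs => rw [pi_eq_sum_univ' w, map_sum]
      simp
    apply hψ
    rw [hrep, ← sum_mul_pderiv_eq_zero hτ hG hδ hF (a' := 0)
      (F' := fun α => ψ (Pi.single α 1))]
    · exact Finset.sum_congr rfl fun _ _ => mul_comm _ _
    · intro k
      simp only [Pi.zero_apply, zero_mul, Finset.sum_const_zero, add_zero]
      rw [← hrep fun α => eval a (jet φ k α)]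
      exact hψW (Submodule.subset_span ⟨k, rfl⟩)
  obtain ⟨z, hz⟩ := (Submodule.mem_span_range_iff_exists_fun ℂ).1 hrow
  have hz' : ∀ α, eval F (pderiv α G) = ∑ k, z k * eval a (jet φ k α) := by
    intro α
    have := congrFun hz α
    rw [Finset.sum_apply] at this
    exact this.symm
  set B : Matrix (Option σ) (Option σ) ℂ := minorMatrix (fun k α => eval a (jet φ k α)) τ with hB
  have hBdet : IsUnit B.det := by
    have : B.det = eval a (minorMatrix (jet φ) τ).det := by
      rw [RingHom.map_det]
      rfl
    rw [this]
    exact hδ.isUnit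
  have hzQ : Matrix.vecMul (fun k => z (some k)) (hessian φ F a) = 0 := by
    ext l
    -- the tangent vector of the conormal variety over the `l`-th basis vector
    set r : Option σ → ℂ := fun k => ∑ α, eval a (pderiv l (jet φ k α)) * F α with hr
    set F' : ι → ℂ := extendZero τ (-(B⁻¹.mulVec r)) with hF'_def
    have hJF' : ∀ k, ∑ α, eval a (jet φ k α) * F' α = -r k := by
      intro k
      rw [hF'_def, sum_mul_extendZero]
      have h1 := congrFun (Matrix.mulVec_mulVec r B B⁻¹) k
      rw [Matrix.mul_nonsing_inv _ hBdet, Matrix.one_mulVec] at h1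
      rw [← h1]
      exact congrFun (Matrix.mulVec_neg (B⁻¹.mulVec r) B) k
    have h := sum_mul_pderiv_eq_zero hτ hG hδ hF (a' := Pi.single l 1) (F' := F') (by
      intro k
      have h2 : ∀ α, ∑ m, (Pi.single l 1 : σ → ℂ) m * eval a (pderiv m (jet φ k α)) =
          eval a (pderiv l (jet φ k α)) := fun α => by simp [Pi.single_apply]
      simp only [Finset.sum_add_distrib, hJF', h2]
      exact neg_add_cancel _)
    simp only [hz', Finset.mul_sum] at h
    rw [Finset.sum_comm] at h
    have h3 : ∀ k, ∑ α, F' α * (z k * eval a (jet φ k α)) = -(z k * r k) := by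
      intro k
      rw [← mul_neg, ← hJF' k, Finset.mul_sum]
      exact Finset.sum_congr rfl fun _ _ => by ring
    simp only [h3, Finset.sum_neg_distrib, neg_eq_zero] at h
    rw [Fintype.sum_option] at h
    have hr0 : r none = 0 := hF (some l)
    rw [hr0, mul_zero, zero_add] at h
    exact h
  have hz0 := Matrix.eq_zero_of_vecMul_eq_zero hQ hzQ
  refine ⟨z none, fun α => ?_⟩
  rw [hz', Fintype.sum_option, Finset.sum_eq_zero, add_zero]
  · rfl
  · intro k _
    rw [show z (some k) = 0 from congrFun hz0 k, zero_mul]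

/-- The hypotheses under which a parametrized variety has a hypersurface as dual variety: some
minor of the jet matrix does not vanish at `a₀`, and the second fundamental form at `a₀` in the
direction of some linear form `F₀` vanishing on the tangent space is nondegenerate. -/
structure HasNondegenerateDual (φ : ι → MvPolynomial σ ℂ) (τ : Option σ → ι) : Prop where
  injective : Function.Injective τ
  exists_point : ∃ (a₀ : σ → ℂ) (F₀ : ι → ℂ), eval a₀ (minorMatrix (jet φ) τ).det ≠ 0 ∧
    (∀ k, ∑ α, eval a₀ (jet φ k α) * F₀ α = 0) ∧ (hessian φ F₀ a₀).det ≠ 0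

omit [DecidableEq ι] in
theorem HasNondegenerateDual.det_ne_zero (h : HasNondegenerateDual φ τ) :
    (minorMatrix (jet φ) τ).det ≠ 0 := by
  obtain ⟨a₀, F₀, h1, -⟩ := h.exists_point
  rintro h0
  rw [h0, map_zero] at h1
  exact h1 rfl

/-- Reflexivity at all points of the conormal variety over the open set where the chosen minor does
not vanish: being proportional is a closed condition. -/
theorem HasNondegenerateDual.mul_pderiv_eq (h : HasNondegenerateDual φ τ)
    (hG : bind₁ (conormalMap φ τ) G = 0) {a : σ → ℂ} {F : ι → ℂ}
    (hδ : eval a (minorMatrix (jet φ) τ).det ≠ 0)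
    (hF : ∀ k, ∑ α, eval a (jet φ k α) * F α = 0) (α β : ι) :
    polyMap φ a α * eval F (pderiv β G) = polyMap φ a β * eval F (pderiv α G) := by
  have hτ := h.injective
  set Ψ := conormalMap φ τ with hΨ
  let δ : MvPolynomial (σ ⊕ {s // s ∉ Set.range τ}) ℂ :=
    rename Sum.inl (minorMatrix (jet φ) τ).det
  let Q : Matrix σ σ (MvPolynomial (σ ⊕ {s // s ∉ Set.range τ}) ℂ) :=
    Matrix.of fun k l => ∑ α, rename Sum.inl (pderiv l (pderiv k (φ α))) * Ψ α
  let M : MvPolynomial (σ ⊕ {s // s ∉ Set.range τ}) ℂ :=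
    rename Sum.inl (φ α) * bind₁ Ψ (pderiv β G) - rename Sum.inl (φ β) * bind₁ Ψ (pderiv α G)
  have hδe : ∀ (b : σ → ℂ) (u : {s // s ∉ Set.range τ} → ℂ), eval (Sum.elim b u) δ =
      eval b (minorMatrix (jet φ) τ).det := fun b u => by
    simp only [δ, eval_rename, Sum.elim_comp_inl]
  have hQe : ∀ (b : σ → ℂ) (u : {s // s ∉ Set.range τ} → ℂ), eval (Sum.elim b u) Q.det =
      (hessian φ (polyMap Ψ (Sum.elim b u)) b).det := fun b u => by
    rw [RingHom.map_det]
    congr 1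
    ext k l
    simp [Q, hessian, eval_rename, polyMap]
  have hMe : ∀ (b : σ → ℂ) (u : {s // s ∉ Set.range τ} → ℂ), eval (Sum.elim b u) M =
      polyMap φ b α * eval (polyMap Ψ (Sum.elim b u)) (pderiv β G) -
        polyMap φ b β * eval (polyMap Ψ (Sum.elim b u)) (pderiv α G) := fun b u => by
    simp only [M, map_sub, map_mul, eval_rename, Sum.elim_comp_inl, eval_polyMap]
    rfl
  have hpt : ∀ {b : σ → ℂ} {F : ι → ℂ}, eval b (minorMatrix (jet φ) τ).det ≠ 0 →
      (∀ k, ∑ α, eval b (jet φ k α) * F α = 0) →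
      ∃ u : {s // s ∉ Set.range τ} → ℂ, polyMap Ψ (Sum.elim b u) = F := by
    intro b F hb hF
    obtain ⟨u, hu⟩ := exists_aeval_conormalMap (R := ℂ) (φ := φ) (a := b) (F := F) hτ hF hb.isUnit
    exact ⟨u, funext hu⟩
  have hMδQ : M * (δ * Q.det) = 0 := by
    refine MvPolynomial.funext fun x => ?_
    rw [← Sum.elim_comp_inl_inr x, map_mul, map_mul, hδe, hQe, hMe, map_zero]
    by_cases hb : eval (x ∘ Sum.inl) (minorMatrix (jet φ) τ).det = 0
    · rw [hb, zero_mul, mul_zero]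
    by_cases hq : (hessian φ (polyMap Ψ (Sum.elim (x ∘ Sum.inl) (x ∘ Sum.inr)))
        (x ∘ Sum.inl)).det = 0
    · rw [hq, mul_zero, mul_zero]
    obtain ⟨c, hc⟩ := exists_pderiv_eq_smul hτ hG hb
      (sum_jet_mul_conormalMap φ τ (x ∘ Sum.inl) (x ∘ Sum.inr)) hq
    rw [hc, hc]
    ring
  have hδQ : δ * Q.det ≠ 0 := by
    obtain ⟨a₀, F₀, h1, h2, h3⟩ := h.exists_point
    obtain ⟨u₀, hu₀⟩ := hpt h1 h2
    intro h0
    have := congrArg (eval (Sum.elim a₀ u₀)) h0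
    rw [map_mul, hδe, hQe, hu₀, map_zero] at this
    exact mul_ne_zero h1 h3 this
  obtain ⟨u, hu⟩ := hpt hδ hF
  have h4 := hMe a u
  rw [(mul_eq_zero.1 hMδQ).resolve_right hδQ, map_zero, hu] at h4
  exact (sub_eq_zero.1 h4.symm)

/-! ### Contact loci -/

variable {X : Set (ProjSpace ι)}

/-- If the gradient at `F` of an equation of the dual variety is nonzero, then it is the only
possible point of tangency of the hyperplane `F`. This includes the singular points `x` of `X`:
a hyperplane tangent at `x` is the differential at `x` of some `f` in the ideal of `X`, and it is
the specialization at `x` of the differentials of `f` at the smooth points of `X`. -/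
theorem IsParametrizedBy.subsingleton_contactLocus (hX : IsParametrizedBy X φ)
    (hφ : HasNondegenerateDual φ τ) (hG : bind₁ (conormalMap φ τ) G = 0) {F : ι → ℂ}
    (hF : F ≠ 0) {α₀ : ι} (hα₀ : eval F (pderiv α₀ G) ≠ 0) :
    (contactLocus X (hyperplane (ProjSpace.mk F hF))).Subsingleton := by
  have key : ∀ x ∈ contactLocus X (hyperplane (ProjSpace.mk F hF)), ∀ α β,
      x.coords α * eval F (pderiv β G) = x.coords β * eval F (pderiv α G) := by
    rintro x ⟨hxX, hx⟩ α β
    obtain ⟨f, hf, hfh⟩ : ∃ f ∈ vanishingIdeal ℂ (affineCone X),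
        ∀ i, F i = eval x.coords (pderiv i f) := by
      obtain ⟨f, hf, hfh⟩ := exists_eq_pderiv_of_tangentSpace_le hx
      obtain ⟨c, hc, hcF⟩ := ProjSpace.exists_coords_mk F hF
      refine ⟨C c⁻¹ * f, Ideal.mul_mem_left _ _ hf, fun i => ?_⟩
      rw [pderiv_C_mul, map_mul, eval_C, ← hfh, hcF, Pi.smul_apply, smul_eq_mul,
        inv_mul_cancel_left₀ hc]
    have hgrad : ∀ v, polyMap (fun i => pderiv i f) v = fun i => eval v (pderiv i f) :=
      fun v => rfl
    have hm : MvPolynomial.X α * bind₁ (fun i => pderiv i f) (pderiv β G) -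
        MvPolynomial.X β * bind₁ (fun i => pderiv i f) (pderiv α G) ∈
          vanishingIdeal ℂ (affineCone X) := by
      refine hX.mem_vanishingIdeal hφ.det_ne_zero fun a ha c => ?_
      rw [map_sub, map_mul, map_mul, eval_X, eval_X, ← eval_polyMap, ← eval_polyMap, hgrad]
      by_cases hc : c = 0
      · simp [hc]
      have := hφ.mul_pderiv_eq hG ha (F := fun i => eval (c • polyMap φ a) (pderiv i f))
        (fun k => by
          have := (mul_eq_zero.1 (hX.sum_pderiv_mul_jet hf c a k)).resolve_left hc
          rw [← this]
          exact Finset.sum_congr rfl fun _ _ => mul_comm _ _) α β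
      rw [Pi.smul_apply, Pi.smul_apply, smul_eq_mul, smul_eq_mul, mul_assoc, this]
      ring
    have h1 := (mem_vanishingIdeal_iff.1 hm) _ (coords_mem_affineCone hxX)
    rw [aeval_eq_eval, map_sub, map_mul, map_mul, eval_X, eval_X, ← eval_polyMap, ← eval_polyMap,
      hgrad, ← funext hfh] at h1
    exact sub_eq_zero.1 h1
  intro x hx y hy
  rw [← ProjSpace.mk_coords x, ← ProjSpace.mk_coords y]
  have hy0 : y.coords α₀ ≠ 0 := by
    intro h0
    refine y.rep_nonzero (funext fun α => ?_)
    have := key y hy α α₀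
    rw [h0, zero_mul] at this
    exact (mul_eq_zero.1 this).resolve_right hα₀
  refine (Projectivization.mk_eq_mk_iff' ℂ _ _ _ _).2 ⟨x.coords α₀ / y.coords α₀, ?_⟩
  ext α
  have h1 := key x hx α α₀
  have h2 := key y hy α α₀
  change x.coords α₀ / y.coords α₀ * y.coords α = x.coords α
  rw [div_mul_eq_mul_div, div_eq_iff hy0]
  apply mul_right_cancel₀ hα₀
  linear_combination x.coords α₀ * h2 - y.coords α₀ * h1

theorem topologicalKrullDim_nonpos_of_subsingleton {T : Type} [TopologicalSpace T]
    {S : Set T} (hS : S.Subsingleton) : topologicalKrullDim S ≤ 0 := by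
  have : Subsingleton S := hS.coe_sort
  have : Subsingleton (TopologicalSpace.IrreducibleCloseds S) := by
    refine ⟨fun A B => TopologicalSpace.IrreducibleCloseds.ext ?_⟩
    rw [Set.Nonempty.eq_univ A.isIrreducible.nonempty, Set.Nonempty.eq_univ B.isIrreducible.nonempty]
  exact Order.krullDim_nonpos_of_subsingleton

end ProjVar

namespace ProjVar

open MvPolynomial

variable {ι σ : Type} [Fintype ι] [Fintype σ] [DecidableEq ι] [DecidableEq σ]
  {X : Set (ProjSpace ι)} {φ : ι → MvPolynomial σ ℂ} {τ : Option σ → ι}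

omit [DecidableEq ι] [Fintype ι] in
theorem polyMap_ne_zero {a : σ → ℂ} (h : eval a (minorMatrix (jet φ) τ).det ≠ 0) :
    polyMap φ a ≠ 0 := by
  intro h0
  rw [RingHom.map_det] at h
  exact h (Matrix.det_eq_zero_of_row_eq_zero none fun l => congrFun h0 (τ l))

theorem HasNondegenerateDual.exists_conormalMap_ne_zero [Nonempty σ]
    (h : HasNondegenerateDual φ τ) : ∃ α, conormalMap φ τ α ≠ 0 := by
  obtain ⟨a₀, F₀, h1, h2, h3⟩ := h.exists_point
  by_contra! h0
  obtain ⟨u, hu⟩ := exists_aeval_conormalMap (R := ℂ) h.injective h2 h1.isUnit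
  have hF : ∀ α, F₀ α = 0 := fun α => by rw [← hu, h0, map_zero]
  apply h3
  have : hessian φ F₀ a₀ = 0 := by
    ext k l
    simp [hessian, hF]
  rw [this, Matrix.det_zero]

/-- Some point of a given dense open subset of `X` has tangent hyperplanes, and the general one of
them is tangent to `X` at one point only. -/
theorem IsParametrizedBy.exists_point [Nonempty σ] (hX : IsParametrizedBy X φ)
    (hφ : HasNondegenerateDual φ τ) {U : Set X} (hU : IsOpen U) (hUd : Dense U) :
    ∃ p ∈ U, ∀ V : Set (tangentHyperplanes X p.1), IsOpen V → Dense V →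
      ∃ h ∈ V, (contactLocus X (hyperplane h.1)).Subsingleton := by
  set Ψ := conormalMap φ τ with hΨ
  have hXne : Nonempty X := by
    obtain ⟨a₀, -, h1, -⟩ := hφ.exists_point
    exact ⟨⟨_, hX.mk_mem a₀ (polyMap_ne_zero h1)⟩⟩
  obtain ⟨O, hO, rfl⟩ := isOpen_induced_iff.1 hU
  obtain ⟨x, hxO⟩ := hUd.nonempty
  obtain ⟨D₁, hD₁, hD₁O⟩ := hX.exists_mk_mem hO x.2 hxO
  obtain ⟨D₂, hD₂, hD₂T⟩ := hX.exists_tangentSpace hφ.injective hφ.det_ne_zero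
  obtain ⟨G, hG, α₀, hα₀⟩ := exists_dual_equation φ hφ.injective
  obtain ⟨α₁, hα₁⟩ := hφ.exists_conormalMap_ne_zero
  have hinl : ∀ {D : MvPolynomial σ ℂ}, D ≠ 0 →
      rename (Sum.inl : σ → σ ⊕ {s // s ∉ Set.range τ}) D ≠ 0 := fun hD h =>
    hD (rename_injective _ Sum.inl_injective (h.trans (map_zero _).symm))
  obtain ⟨y, hy⟩ := exists_eval_ne_zero (mul_ne_zero (mul_ne_zero (hinl hD₁) (hinl hD₂))
    (mul_ne_zero (hinl hφ.det_ne_zero) (mul_ne_zero hα₀ hα₁)))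
  obtain ⟨a, u, rfl⟩ : ∃ a u, y = Sum.elim a u :=
    ⟨y ∘ Sum.inl, y ∘ Sum.inr, (Sum.elim_comp_inl_inr y).symm⟩
  simp only [map_mul, eval_rename, Sum.elim_comp_inl, mul_ne_zero_iff] at hy
  obtain ⟨⟨hy₁, hy₂⟩, hδ, hyG, hyΨ⟩ := hy
  have ha := polyMap_ne_zero hδ
  refine ⟨⟨ProjSpace.mk _ ha, hX.mk_mem a ha⟩, hD₁O a hy₁ ha, fun V hV hVd => ?_⟩
  have hTH : ∀ h : ProjSpace ι, h ∈ tangentHyperplanes X (ProjSpace.mk _ ha) ↔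
      ∀ k, ∑ α, eval a (jet φ k α) * h.coords α = 0 := fun h => by
    rw [← hD₂T a hy₂ ha]
    exact forall₂_congr fun _ _ => mem_hyperplane
  have hmem : ∀ (v : {s // s ∉ Set.range τ} → ℂ) (hv : polyMap Ψ (Sum.elim a v) ≠ 0),
      ProjSpace.mk _ hv ∈ tangentHyperplanes X (ProjSpace.mk _ ha) := by
    intro v hv
    rw [hTH]
    obtain ⟨c, hc, hcv⟩ := ProjSpace.exists_coords_mk _ hv
    intro k
    rw [hcv, ← mul_zero c, ← sum_jet_mul_conormalMap φ τ a v k, Finset.mul_sum]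
    exact Finset.sum_congr rfl fun _ _ => mul_left_comm _ _ _
  have hTHne : Nonempty (tangentHyperplanes X (ProjSpace.mk _ ha)) :=
    ⟨⟨_, hmem u fun h0 => hyΨ (congrFun h0 α₁)⟩⟩
  obtain ⟨O', hO', rfl⟩ := isOpen_induced_iff.1 hV
  obtain ⟨h₁, hh₁⟩ := hVd.nonempty
  obtain ⟨k, e, he, heh, heO⟩ := ProjSpace.exists_basicOpen_subset hO' hh₁
  obtain ⟨u₁, hu₁⟩ := exists_aeval_conormalMap (R := ℂ) hφ.injective ((hTH _).1 h₁.2) hδ.isUnit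
  have hu₁' : polyMap Ψ (Sum.elim a u₁) = h₁.1.coords := funext hu₁
  -- the polynomials in the coordinates of the tangent hyperplane, the point being fixed
  let spec : MvPolynomial (σ ⊕ {s // s ∉ Set.range τ}) ℂ →ₐ[ℂ]
      MvPolynomial {s // s ∉ Set.range τ} ℂ :=
    bind₁ (Sum.elim (fun k => C (a k)) MvPolynomial.X)
  have hspec : ∀ q v, eval v (spec q) = eval (Sum.elim a v) q := by
    intro q v
    simp only [spec]
    rw [← eval_polyMap]
    congr 2
    ext (k | s) <;> simp [polyMap]
  have hspec0 : ∀ {q} v, eval (Sum.elim a v) q ≠ 0 → spec q ≠ 0 := fun v hq h0 =>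
    hq (by rw [← hspec, h0, map_zero])
  obtain ⟨v, hv⟩ := exists_eval_ne_zero (mul_ne_zero (hspec0 (q := bind₁ Ψ e) u₁ (by
    rwa [← eval_polyMap, hu₁'])) (mul_ne_zero (hspec0 u hyG) (hspec0 u hyΨ)))
  simp only [map_mul, hspec, mul_ne_zero_iff] at hv
  obtain ⟨hve, hvG, hvΨ⟩ := hv
  have hF : polyMap Ψ (Sum.elim a v) ≠ 0 := fun h0 => hvΨ (congrFun h0 α₁)
  refine ⟨⟨ProjSpace.mk _ hF, hmem v hF⟩, heO ?_, ?_⟩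
  · obtain ⟨c, hc, hcv⟩ := ProjSpace.exists_coords_mk _ hF
    have hve' : eval (polyMap Ψ (Sum.elim a v)) e ≠ 0 := by rwa [eval_polyMap]
    have := mul_ne_zero (pow_ne_zero k hc) hve'
    rwa [← eval_smul_of_isHomogeneous he, ← hcv] at this
  · have hvG' : eval (polyMap Ψ (Sum.elim a v)) (pderiv α₀ G) ≠ 0 := by rwa [eval_polyMap]
    exact hX.subsingleton_contactLocus hφ hG hF hvG'

theorem IsParametrizedBy.not_isOneWeaklyDefective [Nonempty σ] (hX : IsParametrizedBy X φ)
    (hφ : HasNondegenerateDual φ τ) : ¬ IsOneWeaklyDefective X := by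
  rintro ⟨U, hU, hUd, h⟩
  obtain ⟨p, hp, hpV⟩ := hX.exists_point hφ hU hUd
  obtain ⟨V, hV, hVd, hdim⟩ := h p hp
  obtain ⟨t, ht, hsub⟩ := hpV V hV hVd
  exact not_lt_of_ge (topologicalKrullDim_nonpos_of_subsingleton hsub) (hdim t ht)

theorem IsParametrizedBy.not_isOneTangentiallyWeaklyDefective [Nonempty σ]
    (hX : IsParametrizedBy X φ) (hφ : HasNondegenerateDual φ τ) :
    ¬ IsOneTangentiallyWeaklyDefective X := by
  rintro ⟨U, hU, hUd, h⟩
  obtain ⟨p, hp, hpV⟩ := hX.exists_point hφ hU hUd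
  obtain ⟨t, -, hsub⟩ := hpV Set.univ isOpen_univ dense_univ
  -- the tangential contact locus is contained in the contact locus of any tangent hyperplane
  exact not_lt_of_ge (topologicalKrullDim_nonpos_of_subsingleton
    (hsub.anti fun x hx => ⟨hx.1, hx.2.trans t.2⟩)) (h p hp)

end ProjVar

namespace Chow

open MvPolynomial ProjVar

/-! ### Coefficients of products of linear forms -/

variable {d n : ℕ}

/-- The exponents of the monomial `∏ k, x_{g k}`. -/
def exponent (g : Fin d → Fin (n + 1)) : Fin (n + 1) →₀ ℕ := ∑ k, Finsupp.single (g k) 1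

theorem exponent_mem (g : Fin d → Fin (n + 1)) :
    exponent g ∈ (Finset.univ : Finset (Fin (n + 1))).finsuppAntidiag d := by
  rw [Finset.mem_finsuppAntidiag]
  refine ⟨?_, Finset.subset_univ _⟩
  simp only [exponent, Finsupp.finsetSum_apply]
  rw [Finset.sum_comm]
  simp [Finsupp.single_apply]

theorem exponent_update (g : Fin d → Fin (n + 1)) (i : Fin d) (j : Fin (n + 1)) :
    exponent (Function.update g i j) + Finsupp.single (g i) 1 =
      exponent g + Finsupp.single j 1 := by
  classical
  rw [exponent, exponent, ← Finset.add_sum_erase _ _ (Finset.mem_univ i),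
    ← Finset.add_sum_erase (a := i) _ (fun k => Finsupp.single (g k) 1) (Finset.mem_univ i),
    Function.update_self, Finset.sum_congr rfl fun k hk => by
      rw [Function.update_of_ne (Finset.ne_of_mem_erase hk)]]
  abel

/-- The coefficients of the product of the linear forms `∑ j, L k j * x_j`, for coefficients in any
commutative ring. -/
def prodCoeff {R : Type} [CommRing R] (L : Fin d → Fin (n + 1) → R) (m : Exponents d n) : R :=
  ∑ g : Fin d → Fin (n + 1), if exponent g = m.1 then ∏ k, L k (g k) else 0

theorem coeffs_prod_linearForm (a : Fin d → Fin (n + 1) → ℂ) :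
    coeffs d n (∏ k, linearForm (a k)) = prodCoeff a := by
  ext m
  simp only [coeffs, prodCoeff, linearForm, Finset.prod_univ_sum, Fintype.piFinset_univ,
    coeff_sum, Finset.prod_mul_distrib, ← map_prod, coeff_C_mul]
  refine Finset.sum_congr rfl fun g _ => ?_
  have h : ∏ k, (X (g k) : MvPolynomial (Fin (n + 1)) ℂ) = monomial (exponent g) 1 :=
    (monomial_sum_one _ _).symm
  rw [h, coeff_monomial]
  split_ifs <;> simp

theorem map_prodCoeff {R R' : Type} [CommRing R] [CommRing R'] (f : R →+* R')
    (L : Fin d → Fin (n + 1) → R) (m : Exponents d n) :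
    f (prodCoeff L m) = prodCoeff (fun k j => f (L k j)) m := by
  simp only [prodCoeff, map_sum]
  refine Finset.sum_congr rfl fun g _ => ?_
  split_ifs <;> simp

theorem prodCoeff_mul {R : Type} [CommRing R] (c : Fin d → R) (L : Fin d → Fin (n + 1) → R) :
    prodCoeff (fun k j => c k * L k j) = (∏ k, c k) • prodCoeff L := by
  ext m
  simp only [prodCoeff, Pi.smul_apply, smul_eq_mul, Finset.mul_sum, Finset.prod_mul_distrib,
    mul_ite, mul_zero]

/-! ### A chart of the Chow variety -/

variable (v : Fin d → Fin (n + 1))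

/-- The indices of the parameters of the chart around `∏ k, x_{v k}`: the coefficients of the
linear forms `L k`, except the coefficient of `x_{v k}` in `L k`, which is normalized to `1`. -/
abbrev ChartIndex : Type := {q : Fin d × Fin (n + 1) // q.2 ≠ v q.1}

/-- The coefficients of the normalized linear forms. -/
def chartForm {R : Type} [CommRing R] (a : ChartIndex v → R) (k : Fin d) (j : Fin (n + 1)) : R :=
  if h : j ≠ v k then a ⟨(k, j), h⟩ else 1

/-- The coefficients of the product of the normalized linear forms. -/
def chart (m : Exponents d n) : MvPolynomial (ChartIndex v) ℂ := prodCoeff (chartForm v X) m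

theorem polyMap_chart (a : ChartIndex v → ℂ) :
    polyMap (chart v) a = coeffs d n (∏ k, linearForm (chartForm v a k)) := by
  rw [coeffs_prod_linearForm]
  ext m
  rw [polyMap, chart, map_prodCoeff]
  congr 1
  ext k j
  simp only [chartForm]
  split_ifs <;> simp

/-- The products of normalized linear forms are Zariski dense in the Chow variety. -/
theorem isParametrizedBy_chart : IsParametrizedBy (chowVariety d n) (chart v) where
  mk_mem a h := by
    refine subset_closure ⟨chartForm v a, ?_, ?_⟩
    · rwa [← polyMap_chart]
    · congr 1
      exact polyMap_chart v a
  eval_coords e f hf hfa := by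
    have hzero : ∀ b : Fin d → Fin (n + 1) → ℂ, eval (prodCoeff b) f = 0 := by
      let Φ : Exponents d n → MvPolynomial (Fin d × Fin (n + 1)) ℂ :=
        prodCoeff fun k j => X (k, j)
      have hΦ : ∀ b, polyMap Φ b = prodCoeff fun k j => b (k, j) := by
        intro b
        ext m
        simp [polyMap, Φ, map_prodCoeff]
      have h0 : bind₁ Φ f * ∏ k, X (k, v k) = 0 := by
        refine MvPolynomial.funext fun b => ?_
        rw [map_mul, ← eval_polyMap, hΦ, map_prod, map_zero]
        simp only [eval_X]
        by_cases hb : ∏ k, b (k, v k) = 0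
        · rw [hb, mul_zero]
        have hb' : ∀ k, b (k, v k) ≠ 0 := fun k =>
          Finset.prod_ne_zero_iff.1 hb k (Finset.mem_univ k)
        have hnorm : (fun k j => b (k, j)) = fun k j => b (k, v k) *
            chartForm v (fun q => b q.1 / b (q.1.1, v q.1.1)) k j := by
          ext k j
          simp only [chartForm]
          split_ifs with h
          · rw [mul_div_cancel₀ _ (hb' k)]
          · rw [not_not.1 h, mul_one]
        rw [hnorm, prodCoeff_mul, eval_smul_of_isHomogeneous hf, ← coeffs_prod_linearForm,
          ← polyMap_chart, hfa, mul_zero, zero_mul]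
      intro b
      have h1 := (mul_eq_zero.1 h0).resolve_right
        (Finset.prod_ne_zero_iff.2 fun k _ => X_ne_zero _)
      have h2 := eval_polyMap Φ (fun q => b q.1 q.2) f
      rwa [h1, map_zero, hΦ] at h2
    have hclosed : IsClosed {x : ProjSpace (Exponents d n) | eval x.coords f = 0} := by
      refine ⟨?_⟩
      exact ProjSpace.isOpen_basicOpen hf
    refine fun x hx => closure_minimal ?_ hclosed hx
    rintro _ ⟨a, h, rfl⟩
    obtain ⟨c, -, hc⟩ := ProjSpace.exists_coords_mk _ h
    change eval (ProjSpace.mk _ h).coords f = 0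
    rw [hc, eval_smul_of_isHomogeneous hf, coeffs_prod_linearForm, hzero, mul_zero]

/-! ### The second fundamental form at a product of distinct variables -/

/-- The exponents of the monomial of the parameters that is multiplied with `∏ k, x_{g k}` in the
expansion of the product of the normalized linear forms. -/
def paramExponent (g : Fin d → Fin (n + 1)) : ChartIndex v →₀ ℕ :=
  Finsupp.equivFunOnFinite.symm fun q => if g q.1.1 = q.1.2 then 1 else 0

theorem paramExponent_apply (g : Fin d → Fin (n + 1)) (q : ChartIndex v) :
    paramExponent v g q = if g q.1.1 = q.1.2 then 1 else 0 := rfl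

theorem paramExponent_injective : Function.Injective (paramExponent v) := by
  intro g g' h
  have key : ∀ (q : ChartIndex v), g q.1.1 = q.1.2 ↔ g' q.1.1 = q.1.2 := by
    intro q
    have := DFunLike.congr_fun h q
    rw [paramExponent_apply, paramExponent_apply] at this
    split_ifs at this <;> simp_all
  ext1 k
  by_cases h1 : g k = v k
  · by_contra h2
    have h3 : g' k ≠ v k := fun h3 => h2 (h1.trans h3.symm)
    exact h2 ((key ⟨(k, g' k), h3⟩).2 rfl)
  · exact ((key ⟨(k, g k), h1⟩).1 rfl).symm

theorem prod_chartForm (g : Fin d → Fin (n + 1)) :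
    ∏ k, chartForm v (X : ChartIndex v → MvPolynomial (ChartIndex v) ℂ) k (g k) =
      monomial (paramExponent v g) 1 := by
  classical
  have h1 : paramExponent v g =
      ∑ k, if h : g k ≠ v k then Finsupp.single (⟨(k, g k), h⟩ : ChartIndex v) 1 else 0 := by
    ext q
    rw [paramExponent_apply, Finsupp.finsetSum_apply, Finset.sum_eq_single q.1.1]
    · by_cases hq : g q.1.1 = q.1.2
      · have hne : g q.1.1 ≠ v q.1.1 := hq ▸ q.2
        have hq' : (⟨(q.1.1, g q.1.1), hne⟩ : ChartIndex v) = q :=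
          Subtype.ext (Prod.ext rfl hq)
        rw [if_pos hq, dif_pos hne, hq', Finsupp.single_eq_same]
      · rw [if_neg hq]
        split_ifs with hne
        · rw [Finsupp.single_apply, if_neg]
          exact fun h => hq (congrArg (fun r : ChartIndex v => r.1.2) h)
        · rfl
    · intro k _ hk
      split_ifs with hne
      · rw [Finsupp.single_apply, if_neg]
        exact fun h => hk (congrArg (fun r : ChartIndex v => r.1.1) h)
      · rfl
    · simp
  rw [h1, monomial_sum_one]
  refine Finset.prod_congr rfl fun k _ => ?_
  rw [chartForm]
  split_ifs <;> rfl

theorem coeff_chart (e : ChartIndex v →₀ ℕ) (m : Exponents d n) :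
    coeff e (chart v m) =
      ∑ g, if exponent g = m.1 then if paramExponent v g = e then 1 else 0 else 0 := by
  rw [chart, prodCoeff, coeff_sum]
  refine Finset.sum_congr rfl fun g _ => ?_
  split_ifs with h1 h2
  · rw [prod_chartForm, coeff_monomial, if_pos h2]
  · rw [prod_chartForm, coeff_monomial, if_neg h2]
  · rw [coeff_zero]

theorem coeff_paramExponent_chart (g : Fin d → Fin (n + 1)) (m : Exponents d n) :
    coeff (paramExponent v g) (chart v m) = if exponent g = m.1 then 1 else 0 := by
  rw [coeff_chart, Finset.sum_eq_single g]
  · simp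
  · intro g' _ hg'
    rw [if_neg fun h => hg' (paramExponent_injective v h), ite_self]
  · simp

theorem paramExponent_self : paramExponent v v = 0 := by
  ext q
  rw [paramExponent_apply, if_neg fun h => q.2 h.symm]
  rfl

theorem paramExponent_update (g : Fin d → Fin (n + 1)) (q : ChartIndex v)
    (hg : g q.1.1 = v q.1.1) :
    paramExponent v (Function.update g q.1.1 q.1.2) =
      paramExponent v g + Finsupp.single q 1 := by
  classical
  ext r
  rw [Finsupp.add_apply, paramExponent_apply, paramExponent_apply, Finsupp.single_apply]
  by_cases h : r.1.1 = q.1.1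
  · have h1 : ¬ g r.1.1 = r.1.2 := fun h1 => r.2 (by rw [← h1, h, hg])
    rw [h] at h1 ⊢
    rw [Function.update_self, if_neg h1, zero_add]
    refine if_congr ⟨fun h2 => ?_, fun h2 => by rw [h2]⟩ rfl rfl
    exact Subtype.ext (Prod.ext h.symm h2)
  · rw [Function.update_of_ne h, if_neg (c := q = r) fun h2 => h (by rw [h2]), add_zero]

/-- The exponents of the coordinates which, at the origin of the chart, form a basis of the
coordinate functions on the tangent space. -/
def tangentExponent : Option (ChartIndex v) → Exponents d n
  | none => ⟨exponent v, exponent_mem v⟩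
  | some q => ⟨exponent (Function.update v q.1.1 q.1.2), exponent_mem _⟩

theorem eval_zero_eq_coeff {σ : Type} (p : MvPolynomial σ ℂ) : eval 0 p = coeff 0 p := by
  rw [← constantCoeff_eq, ← eval_zero]

theorem eval_zero_jet_chart (k : Option (ChartIndex v)) (m : Exponents d n) :
    eval 0 (jet (chart v) k m) = if tangentExponent v k = m then 1 else 0 := by
  cases k with
  | none =>
    rw [jet, eval_zero_eq_coeff, ← paramExponent_self v, coeff_paramExponent_chart]
    simp [tangentExponent, Subtype.ext_iff]
  | some q =>
    rw [jet, eval_zero_eq_coeff, coeff_pderiv, ← paramExponent_self v,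
      ← paramExponent_update v v q rfl, coeff_paramExponent_chart, paramExponent_self]
    simp [tangentExponent, Subtype.ext_iff]

theorem eval_zero_pderiv_pderiv_chart (q r : ChartIndex v) (m : Exponents d n) :
    eval 0 (pderiv r (pderiv q (chart v m))) =
      if q.1.1 ≠ r.1.1 ∧
        exponent (Function.update (Function.update v q.1.1 q.1.2) r.1.1 r.1.2) = m.1
      then 1 else 0 := by
  classical
  rw [eval_zero_eq_coeff, coeff_pderiv, coeff_pderiv, zero_add]
  by_cases h : q.1.1 = r.1.1
  · rw [if_neg fun h' => h'.1 h, coeff_chart, Finset.sum_eq_zero, zero_mul, zero_mul]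
    -- no term of the expansion contains two coefficients of the same linear form
    intro g _
    rw [if_neg (c := paramExponent v g = _), ite_self]
    intro hg
    have h1 := DFunLike.congr_fun hg q
    have h2 := DFunLike.congr_fun hg r
    rw [paramExponent_apply, Finsupp.add_apply, Finsupp.single_eq_same, Finsupp.single_apply] at h1
    rw [paramExponent_apply, Finsupp.add_apply, Finsupp.single_eq_same, Finsupp.single_apply] at h2
    by_cases hqr : q = r
    · rw [if_pos hqr.symm] at h1
      split_ifs at h1
      omega
    · rw [if_neg (Ne.symm hqr)] at h1
      rw [if_neg hqr] at h2
      refine hqr (Subtype.ext (Prod.ext h ?_))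
      have h1' : g q.1.1 = q.1.2 := by
        by_contra h3
        rw [if_neg h3] at h1
        omega
      have h2' : g r.1.1 = r.1.2 := by
        by_contra h3
        rw [if_neg h3] at h2
        omega
      rw [← h1', ← h2', h]
  · have hqr : q ≠ r := fun h' => h (by rw [h'])
    have h1 : Finsupp.single r 1 + Finsupp.single q 1 =
        paramExponent v (Function.update (Function.update v q.1.1 q.1.2) r.1.1 r.1.2) := by
      rw [paramExponent_update v _ r (Function.update_of_ne (Ne.symm h) _ _),
        paramExponent_update v v q rfl, paramExponent_self, zero_add, add_comm]
    rw [h1, coeff_paramExponent_chart]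
    simp [h, Ne.symm hqr]

/-- A linear form vanishing on the tangent space at `∏ k, x_{v k}`: the sum of the coefficients of
the monomials in which some variable `x_c` has an exponent larger by at least `2` than in
`∏ k, x_{v k}`. Its second fundamental form is nondegenerate when `v` is injective and `3 ≤ d`. -/
def dualForm (m : Exponents d n) : ℂ :=
  if ∃ c, exponent v c + 2 ≤ m.1 c then 1 else 0

variable {v}

theorem tangentExponent_injective (hv : Function.Injective v) :
    Function.Injective (tangentExponent v) := by
  have hsome : ∀ q : ChartIndex v, exponent (Function.update v q.1.1 q.1.2) ≠ exponent v := by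
    intro q h
    have h1 := exponent_update v q.1.1 q.1.2
    rw [h] at h1
    exact q.2 (Finsupp.single_left_injective one_ne_zero (add_left_cancel h1)).symm
  rintro (_ | q) (_ | r) h
  · rfl
  · exact absurd (congrArg Subtype.val h).symm (hsome r)
  · exact absurd (congrArg Subtype.val h) (hsome q)
  · have h0 : exponent (Function.update v q.1.1 q.1.2) =
        exponent (Function.update v r.1.1 r.1.2) := congrArg Subtype.val h
    have hq := exponent_update v q.1.1 q.1.2
    have hr := exponent_update v r.1.1 r.1.2
    rw [h0] at hq
    have hsum : Finsupp.single q.1.2 1 + Finsupp.single (v r.1.1) 1 =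
        (Finsupp.single r.1.2 1 + Finsupp.single (v q.1.1) 1 : Fin (n + 1) →₀ ℕ) := by
      apply add_left_cancel (a := exponent v)
      rw [← add_assoc, ← hq, ← add_assoc, ← hr]
      abel
    have h1 := DFunLike.congr_fun hsum (v q.1.1)
    simp only [Finsupp.add_apply, Finsupp.single_eq_same] at h1
    rw [Finsupp.single_apply, if_neg q.2, Finsupp.single_apply] at h1
    have h2 : v r.1.1 = v q.1.1 := by
      by_contra h2
      rw [if_neg h2] at h1
      omega
    rw [h2] at hsum
    have h3 := Finsupp.single_left_injective one_ne_zero (add_right_cancel hsum)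
    exact congrArg some (Subtype.ext (Prod.ext (hv h2.symm) h3))

theorem dualForm_tangentExponent (k : Option (ChartIndex v)) :
    dualForm v (tangentExponent v k) = 0 := by
  rw [dualForm, if_neg]
  rintro ⟨c, hc⟩
  cases k with
  | none => exact absurd hc (by simp [tangentExponent])
  | some q =>
    have h := DFunLike.congr_fun (exponent_update v q.1.1 q.1.2) c
    rw [Finsupp.add_apply, Finsupp.add_apply, Finsupp.single_apply, Finsupp.single_apply] at h
    change exponent v c + 2 ≤ exponent (Function.update v q.1.1 q.1.2) c at hc
    split_ifs at h <;> omega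

theorem dualForm_update_update {q r : ChartIndex v} (h : q.1.1 ≠ r.1.1) :
    dualForm v ⟨exponent (Function.update (Function.update v q.1.1 q.1.2) r.1.1 r.1.2),
      exponent_mem _⟩ = if q.1.2 = r.1.2 then 1 else 0 := by
  have h1 := exponent_update v q.1.1 q.1.2
  have h2 := exponent_update (Function.update v q.1.1 q.1.2) r.1.1 r.1.2
  rw [Function.update_of_ne (Ne.symm h)] at h2
  refine if_congr ⟨?_, fun hqr => ⟨q.1.2, ?_⟩⟩ rfl rfl
  · rintro ⟨c, hc⟩
    by_contra hqr
    simp only at hc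
    have h1c := DFunLike.congr_fun h1 c
    have h2c := DFunLike.congr_fun h2 c
    simp only [Finsupp.add_apply, Finsupp.single_apply] at h1c h2c
    have : ¬ (q.1.2 = c ∧ r.1.2 = c) := fun hh => hqr (hh.1.trans hh.2.symm)
    split_ifs at h1c h2c <;> omega
  · have h1c := DFunLike.congr_fun h1 q.1.2
    have h2c := DFunLike.congr_fun h2 q.1.2
    simp only [Finsupp.add_apply, Finsupp.single_apply] at h1c h2c
    rw [if_neg (Ne.symm q.2), if_pos trivial] at h1c
    rw [if_neg (fun h' => r.2 (hqr ▸ h'.symm)), if_pos hqr.symm] at h2c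
    simp only
    omega

theorem hessian_chart (q r : ChartIndex v) :
    hessian (chart v) (dualForm v) 0 q r = if q.1.1 ≠ r.1.1 ∧ q.1.2 = r.1.2 then 1 else 0 := by
  rw [hessian, Matrix.of_apply]
  simp only [eval_zero_pderiv_pderiv_chart]
  by_cases h : q.1.1 = r.1.1
  · simp [h]
  · rw [Finset.sum_eq_single
      (⟨exponent (Function.update (Function.update v q.1.1 q.1.2) r.1.1 r.1.2),
        exponent_mem _⟩ : Exponents d n)]
    · rw [dualForm_update_update h, if_pos ⟨h, rfl⟩, one_mul]
      exact if_congr ⟨fun h' => ⟨h, h'⟩, fun h' => h'.2⟩ rfl rfl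
    · intro m _ hm
      rw [if_neg fun h' => hm (Subtype.ext h'.2.symm), zero_mul]
    · simp

/-- For each variable `x_c`, the second fundamental form restricts to the matrix with zeros on the
diagonal and ones elsewhere, indexed by the linear forms whose coefficient of `x_c` is a parameter
of the chart. There are at least two of them, because `3 ≤ d`. -/
theorem det_hessian_chart_ne_zero (hd : 3 ≤ d) (hv : Function.Injective v) :
    (hessian (chart v) (dualForm v) 0).det ≠ 0 := by
  classical
  rw [Ne, ← Matrix.exists_mulVec_eq_zero_iff]
  rintro ⟨z, hz, hz0⟩
  let S : Fin (n + 1) → ℂ := fun c => ∑ r : ChartIndex v, if r.1.2 = c then z r else 0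
  have hzS : ∀ q : ChartIndex v, z q = S q.1.2 := by
    intro q
    have h : ∑ r, hessian (chart v) (dualForm v) 0 q r * z r = 0 := congrFun hz0 q
    have h1 : S q.1.2 = ∑ r, (hessian (chart v) (dualForm v) 0 q r * z r +
        if r = q then z r else 0) := by
      refine Finset.sum_congr rfl fun r _ => ?_
      rw [hessian_chart]
      by_cases h2 : r.1.2 = q.1.2
      · by_cases h3 : r.1.1 = q.1.1
        · rw [if_pos h2, if_neg fun h' => h'.1 h3.symm, if_pos (Subtype.ext (Prod.ext h3 h2)),
            zero_mul, zero_add]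
        · rw [if_pos h2, if_pos ⟨Ne.symm h3, h2.symm⟩, if_neg fun h' => h3 (by rw [h']), one_mul,
            add_zero]
      · rw [if_neg h2, if_neg fun h' => h2 h'.2.symm, if_neg fun h' => h2 (by rw [h']), zero_mul,
          add_zero]
    rw [h1, Finset.sum_add_distrib, h, zero_add, Finset.sum_ite_eq', if_pos (Finset.mem_univ q)]
  have hS : ∀ c, S c = 0 := by
    intro c
    have h1 : S c = (Finset.univ.filter fun r : ChartIndex v => r.1.2 = c).card * S c := by
      rw [← nsmul_eq_mul, ← Finset.sum_const, Finset.sum_filter]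
      refine Finset.sum_congr rfl fun r _ => ?_
      split_ifs with h
      · rw [hzS, h]
      · rfl
    have h2 : 1 < (Finset.univ.filter fun r : ChartIndex v => r.1.2 = c).card := by
      obtain ⟨i, j, hij, hi, hj⟩ : ∃ i j : Fin d, i ≠ j ∧ c ≠ v i ∧ c ≠ v j := by
        have h01 : (⟨0, by omega⟩ : Fin d) ≠ ⟨1, by omega⟩ := by simp
        have h02 : (⟨0, by omega⟩ : Fin d) ≠ ⟨2, by omega⟩ := by simp
        have h12 : (⟨1, by omega⟩ : Fin d) ≠ ⟨2, by omega⟩ := by simp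
        by_cases h0 : c = v ⟨0, by omega⟩
        · exact ⟨_, _, h12, h0 ▸ hv.ne h01, h0 ▸ hv.ne h02⟩
        · by_cases h1 : c = v ⟨1, by omega⟩
          · exact ⟨_, _, h02, h0, h1 ▸ hv.ne h12⟩
          · exact ⟨_, _, h01, h0, h1⟩
      refine Finset.one_lt_card.2 ⟨⟨(i, c), hi⟩, by simp, ⟨(j, c), hj⟩, by simp, fun h => hij ?_⟩
      exact congrArg (fun r : ChartIndex v => r.1.1) h
    have h3 : ((Finset.univ.filter fun r : ChartIndex v => r.1.2 = c).card : ℂ) - 1 ≠ 0 := by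
      rw [sub_ne_zero]
      exact_mod_cast h2.ne'
    apply mul_left_cancel₀ h3
    linear_combination -h1
  exact hz (funext fun q => (hzS q).trans (hS _))

theorem hasNondegenerateDual_chart (hd : 3 ≤ d) (hv : Function.Injective v) :
    HasNondegenerateDual (chart v) (tangentExponent v) where
  injective := tangentExponent_injective hv
  exists_point := by
    refine ⟨0, dualForm v, ?_, fun k => ?_, det_hessian_chart_ne_zero hd hv⟩
    · have h : (eval 0).mapMatrix (minorMatrix (jet (chart v)) (tangentExponent v)) = 1 := by
        ext k l
        rw [RingHom.mapMatrix_apply, Matrix.map_apply, minorMatrix, Matrix.of_apply,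
          eval_zero_jet_chart, Matrix.one_apply]
        exact if_congr (tangentExponent_injective hv).eq_iff rfl rfl
      rw [RingHom.map_det, h, Matrix.det_one]
      exact one_ne_zero
    · simp only [eval_zero_jet_chart, ite_mul, one_mul, zero_mul, Finset.sum_ite_eq,
        Finset.mem_univ, if_true, dualForm_tangentExponent]

end Chow
end

theorem mainTheorem3 (d n : ℕ) (hd : 3 ≤ d) (hdn : d ≤ n + 1) :
    ¬ ProjVar.IsOneWeaklyDefective (Chow.chowVariety d n) ∧
      ¬ ProjVar.IsOneTangentiallyWeaklyDefective (Chow.chowVariety d n) := by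
  have hv : Function.Injective (Fin.castLE hdn) := Fin.castLE_injective hdn
  have hX := Chow.isParametrizedBy_chart (Fin.castLE hdn)
  have hφ := Chow.hasNondegenerateDual_chart hd hv
  have : Nonempty (Chow.ChartIndex (Fin.castLE hdn)) :=
    ⟨⟨(⟨0, by omega⟩, Fin.castLE hdn ⟨1, by omega⟩), hv.ne (by simp)⟩⟩
  exact ⟨hX.not_isOneWeaklyDefective hφ, hX.not_isOneTangentiallyWeaklyDefective hφ⟩
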